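/- **Definitions.** A *simple digraph* $\Gamma=(V,E)$ is a finite directed graph without loops and multiple edges. Let $n=|V|$ be its order, $A$ its adjacency matrix, $D$ the diagonal matrix of out-degrees, $L=D-A$ its Laplacian matrix, and $\mathbf e\in\mathbb C^n$ the all ones vector. Its *restricted numerical range* is $W_r(\Gamma)=\{x^*Lx : x\in\mathbb C^n,\ x\perp \mathbf e,\ \|x\|=1\}$. For $n\ge 2$, its *Laplacian spread* is $\operatorname{sp}(\Gamma)=\beta(\Gamma)-\alpha(\Gamma)$, where $\alpha(\Gamma)$ and $\beta(\Gamma)$ are the minimum and the maximum of $x^TLx$ over real vectors $x\perp\mathbf e$ with $\|x\|=1$. A *restrictor matrix* is an $n\times(n-1)$ complex matrix $Q$ whose columns form an orthonormal basis of $\mathbf e^\perp$; the matrix $Q^*LQ$ is called a restricted Laplacian of $\Gamma$. The digraph $\Gamma$ is *polygonal* if for every restrictor matrix $Q$ the set $W_r(\Gamma)$ is the convex hull of the eigenvalues of $Q^*LQ$. It is *pseudo-normal* if it is polygonal, $L$ is not normal, and $Q^*LQ$ is not normal for any restrictor matrix $Q$. The *directed join* $\Gamma_1\overset{\rightarrow}{\vee}\Gamma_2$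 is the disjoint union of $\Gamma_1$ and $\Gamma_2$ together with all edges $(i,j)$, $i\in V(\Gamma_1)$, $j\in V(\Gamma_2)$. $K_n$ is the complete simple digraph (all edges $(i,j)$ with $i\ne j$) and $\overline{K_n}$ the digraph without edges on $n$ vertices. A *regular tournament* of order $p$ ($p\ge3$ odd) is a simple digraph with exactly one of the edges $(i,j),(j,i)$ for all $i\neq j$ and with all in-degrees and out-degrees equal to $(p-1)/2$. A *regular Pick tournament* $T_p$ of order $p$ is a regular tournament of order $p$ for which the maximum and the minimum of the imaginary parts of the eigenvalues of the adjacency matrix are $\pm\frac12\cot\left(\frac{\pi}{2p}\right)$, respectively. **Theorem 3.5.** 1. Let $p\ge 3$ be an odd integer. A regular Pick tournament of order $p$ exists. For every regular Pick tournament $T_p$ of order $p$ and every integer $t$ with $2\le t\le p$, the digraph $\Gamma=(K_2\overset{\rightarrow}{\vee}T_p)\overset{\rightarrow}{\vee}\overline{K_t}$ is pseudo-normal and $\operatorname{sp}(\Gamma)=n$, where $n=2+p+t$ is the order of $\Gamma$. 2. The polygonal bound is sharp for pseudo-normal digraphs: every polygonal digraph $\Gamma$ of order $n\ge2$ satisfies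 $\operatorname{sp}(\Gamma)\le n$, and for every $n\ge 7$ there is a pseudo-normal digraph of order $n$ with $\operatorname{sp}(\Gamma)=n$. -/

import Mathlib

namespace Digraph

section Basic

variable {V W : Type*}

/-- A digraph is simple if it has no loops (Mathlib's `Digraph` already excludes multiple edges). -/
def IsSimple (Γ : Digraph V) : Prop :=
  ∀ v, ¬ Γ.Adj v v

/-- The complete simple digraph `K_V`: all edges `(i, j)` with `i ≠ j`. -/
def complete (V : Type*) : Digraph V where
  Adj i j := i ≠ j

/-- The directed join: the disjoint union of `Γ₁` and `Γ₂` together with all edges from the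
vertices of `Γ₁` to the vertices of `Γ₂`. -/
def directedJoin (Γ₁ : Digraph V) (Γ₂ : Digraph W) : Digraph (V ⊕ W) where
  Adj
    | Sum.inl i, Sum.inl j => Γ₁.Adj i j
    | Sum.inr i, Sum.inr j => Γ₂.Adj i j
    | Sum.inl _, Sum.inr _ => True
    | Sum.inr _, Sum.inl _ => False

/-- The number of edges of the form `(i, j)`. -/
noncomputable def outDegree (Γ : Digraph V) (i : V) : ℕ :=
  {j | Γ.Adj i j}.ncard

/-- The number of edges of the form `(j, i)`. -/
noncomputable def inDegree (Γ : Digraph V) (i : V) : ℕ :=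
  {j | Γ.Adj j i}.ncard

open Classical in
/-- The adjacency matrix, with entries in `R`. -/
noncomputable def adjMatrix (R : Type*) [Zero R] [One R] (Γ : Digraph V) : Matrix V V R :=
  Matrix.of fun i j => if Γ.Adj i j then 1 else 0

open Classical in
/-- The Laplacian matrix `L = D - A`, where `D` is the diagonal matrix of out-degrees. -/
noncomputable def laplacian (R : Type*) [Ring R] (Γ : Digraph V) : Matrix V V R :=
  Matrix.diagonal (fun i => (Γ.outDegree i : R)) - Γ.adjMatrix R

/-- A tournament: a simple digraph in which any two distinct vertices are joined by exactly one of
the two possible edges. -/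
def IsTournament (Γ : Digraph V) : Prop :=
  Γ.IsSimple ∧ ∀ i j, i ≠ j → (Γ.Adj i j ↔ ¬ Γ.Adj j i)

end Basic

section Finite

variable {V : Type*} [Fintype V]

/-- The restricted numerical range
`W_r(L) = {x* L x : x ∈ ℂⁿ, x ⊥ e, ‖x‖ = 1}`, with the Euclidean norm. -/
def restrictedNumericalRange (Γ : Digraph V) : Set ℂ :=
  {z | ∃ x : V → ℂ, star x ⬝ᵥ 1 = 0 ∧ ‖WithLp.toLp 2 x‖ = 1 ∧
    z = star x ⬝ᵥ (Γ.laplacian ℂ).mulVec x}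

/-- The values `xᵀ L x`, for real unit vectors `x` orthogonal to the all ones vector. -/
def restrictedRayleighSet (Γ : Digraph V) : Set ℝ :=
  {r | ∃ x : V → ℝ, x ⬝ᵥ 1 = 0 ∧ ‖WithLp.toLp 2 x‖ = 1 ∧
    r = x ⬝ᵥ (Γ.laplacian ℝ).mulVec x}

/-- The algebraic connectivity `α(Γ)`: the minimum of `xᵀ L x` over real unit vectors `x ⊥ e`. -/
noncomputable def algebraicConnectivity (Γ : Digraph V) : ℝ :=
  sInf Γ.restrictedRayleighSet

/-- The quantity `β(Γ)`: the maximum of `xᵀ L x` over real unit vectors `x ⊥ e`. -/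
noncomputable def maxRayleigh (Γ : Digraph V) : ℝ :=
  sSup Γ.restrictedRayleighSet

/-- The Laplacian spread `β(Γ) - α(Γ)`. -/
noncomputable def laplacianSpread (Γ : Digraph V) : ℝ :=
  Γ.maxRayleigh - Γ.algebraicConnectivity

/-- A restrictor matrix: an `n × (n - 1)` complex matrix whose columns form an orthonormal basis
of the orthogonal complement of the all ones vector. -/
def IsRestrictor {V : Type*} [Fintype V]
    (Q : Matrix V (Fin (Fintype.card V - 1)) ℂ) : Prop :=
  Q.conjTranspose * Q = 1 ∧
    (Submodule.span ℂ (Set.range fun k : Fin (Fintype.card V - 1) => Q.col k) : Set (V → ℂ)) =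
      {x | star x ⬝ᵥ 1 = 0}

/-- On a non-empty vertex set restrictor matrices exist. -/
theorem exists_isRestrictor (V : Type*) [Fintype V] [Nonempty V] :
    ∃ Q : Matrix V (Fin (Fintype.card V - 1)) ℂ, IsRestrictor Q := by
  classical
  let e : EuclideanSpace ℂ V := WithLp.toLp 2 1
  have he : e ≠ 0 := by
    intro h
    obtain ⟨v⟩ := ‹Nonempty V›
    have := congrArg (fun z : EuclideanSpace ℂ V => z v) h
    simp [e] at this
  let S : Submodule ℂ (EuclideanSpace ℂ V) := (ℂ ∙ e)ᗮ
  have hcard : Module.finrank ℂ S = Fintype.card V - 1 := by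
    have h1 := Submodule.finrank_add_finrank_orthogonal (ℂ ∙ e)
    rw [finrank_span_singleton he, finrank_euclideanSpace] at h1
    change Module.finrank ℂ (ℂ ∙ e)ᗮ = _
    omega
  let b : OrthonormalBasis (Fin (Fintype.card V - 1)) ℂ S :=
    (stdOrthonormalBasis ℂ S).reindex (finCongr hcard)
  refine ⟨Matrix.of fun i k => (b k : EuclideanSpace ℂ V) i, ?_, ?_⟩
  · ext k l
    have h := orthonormal_iff_ite.mp b.orthonormal k l
    rw [Submodule.coe_inner, PiLp.inner_apply] at h
    rw [Matrix.mul_apply, Matrix.one_apply, ← h]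
    refine Finset.sum_congr rfl fun i _ => ?_
    simp [mul_comm]
  · have hb : Submodule.span ℂ (Set.range fun k => (b k : EuclideanSpace ℂ V)) = S := by
      have h := congrArg (Submodule.map S.subtype) b.toBasis.span_eq
      rw [Submodule.map_span, Submodule.map_top, Submodule.range_subtype] at h
      rw [← Set.range_comp] at h
      simpa [Function.comp_def] using h
    have hm := congrArg (Submodule.map (WithLp.linearEquiv 2 ℂ (V → ℂ)).toLinearMap) hb
    rw [Submodule.map_span, ← Set.range_comp] at hm
    have hm' : Submodule.span ℂ (Set.range fun k : Fin (Fintype.card V - 1) =>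
        (Matrix.of fun i k => (b k : EuclideanSpace ℂ V) i).col k) =
        Submodule.map (WithLp.linearEquiv 2 ℂ (V → ℂ)).toLinearMap S := hm
    rw [hm']
    ext x
    have hx : x ∈ Submodule.map (WithLp.linearEquiv 2 ℂ (V → ℂ)).toLinearMap S ↔
        WithLp.toLp 2 x ∈ S := by
      constructor
      · rintro ⟨y, hy, rfl⟩
        simpa using hy
      · intro h
        exact ⟨_, h, by simp⟩
    rw [SetLike.mem_coe, hx, Submodule.mem_orthogonal_singleton_iff_inner_left,
      EuclideanSpace.inner_eq_star_dotProduct]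
    rw [Set.mem_ofPred_eq, dotProduct_comm (star x)]

/-- The restricted Laplacian `Q* L Q`. -/
noncomputable def restrictedLaplacian (Γ : Digraph V)
    (Q : Matrix V (Fin (Fintype.card V - 1)) ℂ) :
    Matrix (Fin (Fintype.card V - 1)) (Fin (Fintype.card V - 1)) ℂ :=
  Q.conjTranspose * Γ.laplacian ℂ * Q

/-- A polygonal digraph: a simple digraph whose restricted numerical range is the convex hull of
the eigenvalues of its restricted Laplacian. -/
def IsPolygonal (Γ : Digraph V) : Prop :=
  Γ.IsSimple ∧ ∀ Q : Matrix V (Fin (Fintype.card V - 1)) ℂ, IsRestrictor Q →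
    Γ.restrictedNumericalRange = convexHull ℝ (spectrum ℂ (Γ.restrictedLaplacian Q))

/-- A pseudo-normal digraph: a polygonal digraph whose Laplacian matrix and restricted Laplacian
matrix are both not normal. -/
structure IsPseudoNormal (Γ : Digraph V) : Prop where
  isPolygonal : Γ.IsPolygonal
  not_normal : ¬ IsStarNormal (Γ.laplacian ℂ)
  not_restricted_normal : ∀ Q : Matrix V (Fin (Fintype.card V - 1)) ℂ, IsRestrictor Q →
    ¬ IsStarNormal (Γ.restrictedLaplacian Q)

/-- A regular tournament: a tournament of odd order `n ≥ 3` in which all in-degrees and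
out-degrees equal `(n - 1) / 2`. -/
structure IsRegularTournament (Γ : Digraph V) : Prop where
  isTournament : Γ.IsTournament
  three_le : 3 ≤ Fintype.card V
  odd : Odd (Fintype.card V)
  outDegree_eq : ∀ i, Γ.outDegree i = (Fintype.card V - 1) / 2
  inDegree_eq : ∀ i, Γ.inDegree i = (Fintype.card V - 1) / 2

open Classical in
/-- A regular Pick tournament: a regular tournament of order `n` for which the maximum and the
minimum imaginary part of an eigenvalue of the adjacency matrix are `± cot (π / (2 n)) / 2`. -/
structure IsRegularPickTournament (Γ : Digraph V) : Prop where
  isRegularTournament : Γ.IsRegularTournament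
  isGreatest_im : IsGreatest (Complex.im '' spectrum ℂ (Γ.adjMatrix ℂ))
    (1 / 2 * Real.cot (Real.pi / (2 * Fintype.card V)))
  isLeast_im : IsLeast (Complex.im '' spectrum ℂ (Γ.adjMatrix ℂ))
    (-(1 / 2 * Real.cot (Real.pi / (2 * Fintype.card V))))

/-- The Rayleigh set is compact. -/
theorem isCompact_restrictedRayleighSet (Γ : Digraph V) :
    IsCompact Γ.restrictedRayleighSet := by
  have h : Γ.restrictedRayleighSet =
      (fun x : EuclideanSpace ℝ V => (x.ofLp : V → ℝ) ⬝ᵥ (Γ.laplacian ℝ).mulVec x.ofLp) ''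
        (Metric.sphere (0 : EuclideanSpace ℝ V) 1 ∩
          {x | (x.ofLp : V → ℝ) ⬝ᵥ (1 : V → ℝ) = 0}) := by
    ext r
    constructor
    · rintro ⟨x, h0, h1, rfl⟩
      exact ⟨WithLp.toLp 2 x, ⟨by simpa using h1, h0⟩, rfl⟩
    · rintro ⟨x, ⟨h1, h0⟩, rfl⟩
      exact ⟨x.ofLp, h0, by simpa using h1, rfl⟩
  rw [h]
  refine IsCompact.image_of_continuousOn ?_ (Continuous.continuousOn ?_)
  · refine (isCompact_sphere _ _).inter_right (isClosed_eq ?_ continuous_const)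
    unfold dotProduct
    fun_prop
  · unfold Matrix.mulVec dotProduct
    fun_prop

/-- On at least two vertices the Rayleigh set is non-empty. -/
theorem restrictedRayleighSet_nonempty [Nontrivial V] (Γ : Digraph V) :
    Γ.restrictedRayleighSet.Nonempty := by
  classical
  obtain ⟨a, b, hab⟩ := exists_pair_ne V
  let y : V → ℝ := Pi.single a 1 - Pi.single b 1
  have hy0 : y ⬝ᵥ 1 = 0 := by simp [y, sub_dotProduct]
  have hy : WithLp.toLp 2 y ≠ 0 := by
    intro h
    have : y a = 0 := by
      have := congrArg (fun z : EuclideanSpace ℝ V => z a) h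
      simpa using this
    simp [y, hab] at this
  refine ⟨_, (‖WithLp.toLp 2 y‖⁻¹) • y, ?_, ?_, rfl⟩
  · rw [smul_dotProduct, hy0, smul_zero]
  · rw [WithLp.toLp_smul]
    exact norm_smul_inv_norm (𝕜 := ℝ) hy

/-- The minimum defining the algebraic connectivity is attained. -/
theorem isLeast_algebraicConnectivity [Nontrivial V] (Γ : Digraph V) :
    IsLeast Γ.restrictedRayleighSet Γ.algebraicConnectivity :=
  Γ.isCompact_restrictedRayleighSet.isLeast_sInf Γ.restrictedRayleighSet_nonempty

/-- The maximum defining `β(Γ)` is attained. -/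
theorem isGreatest_maxRayleigh [Nontrivial V] (Γ : Digraph V) :
    IsGreatest Γ.restrictedRayleighSet Γ.maxRayleigh :=
  Γ.isCompact_restrictedRayleighSet.isGreatest_sSup Γ.restrictedRayleighSet_nonempty

end Finite

end Digraph

/-! Write e for the all ones vector, n = 2 + p + t, m = p/2 + t and h = cot(π/(2p))/2. For the join
of K₂, T_p and K̄_t the set W_r is the quadrilateral with vertices 0, n and m ± hi. The vertices are
eigenvalues of L with orthonormal eigenvectors in e^⊥: a zero-sum vector on K̄_t, one on K₂, and two
extremal adjacency eigenvectors of T_p. Combining these with the square roots of barycentric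
coordinates as coefficients reaches every point of the quadrilateral
(`sum_smul_mem_restrictedNumericalRange`).

Conversely, let a unit vector in e^⊥ have entries summing to u over K₂ and to v over T_p, and let y
be its T_p block. As A + Aᵀ = J - I for a tournament, the form depends only on the block norms, u, v
and Im y*Ay, and the last is at most h(‖y‖² - |v|²/p) in absolute value. The side inequalities then
say that binary Hermitian forms in u, v are nonnegative (`abs_im_le_of_quadratic_form`). Their
discriminants have the right sign because t ≤ p and h² ≥ p²/12; the latter holds since x cot x on
(0, π/6] is at least its value at π/6, the case p = 3. All restricted eigenvalues lie in W_r, so W_r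
is their hull and the remaining ones need not be computed. The quadrilateral meets the real axis in
[0, n], so the spread is n.

Normality fails because the joins are one-sided: e is a right but not a left null vector of L, and
the restricted eigenvector constant on K₂ ∪ T_p and on K̄_t is not an eigenvector of Lᴴ.

For any polygonal digraph, Gershgorin's theorem for L and for the Laplacian of the complement puts
the restricted eigenvalues in the strip 0 ≤ Re ≤ n, whence the general bound. Pick tournaments exist
because the rotational tournament is a circulant with explicit eigenvalues. -/

open Matrix

/-! ### Eigenvectors, normality and Hermitian forms -/

namespace Matrix

theorem mem_spectrum_iff_exists_mulVec {ι : Type*} [Fintype ι] [DecidableEq ι] {M : Matrix ι ι ℂ}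
    {μ : ℂ} : μ ∈ spectrum ℂ M ↔ ∃ v, v ≠ 0 ∧ M *ᵥ v = μ • v := by
  rw [← Matrix.spectrum_toLin', ← Module.End.hasEigenvalue_iff_mem_spectrum]
  constructor
  · intro h
    obtain ⟨v, hv⟩ := h.exists_hasEigenvector
    exact ⟨v, hv.2, by simpa using hv.apply_eq_smul⟩
  · rintro ⟨v, hv, h⟩
    exact Module.End.hasEigenvalue_of_hasEigenvector (x := v)
      ⟨Module.End.mem_eigenspace_iff.2 (by simpa using h), hv⟩

theorem star_dotProduct_self_eq_sum {ι : Type*} [Fintype ι] (x : ι → ℂ) :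
    star x ⬝ᵥ x = ((∑ i, Complex.normSq (x i) : ℝ) : ℂ) := by
  simp [dotProduct, Complex.normSq_eq_conj_mul_self]

theorem norm_toLp_eq_one_iff {ι : Type*} [Fintype ι] (x : ι → ℂ) :
    ‖WithLp.toLp 2 x‖ = 1 ↔ star x ⬝ᵥ x = 1 := by
  rw [star_dotProduct_self_eq_sum, ← Complex.ofReal_one, Complex.ofReal_inj,
    ← sq_eq_sq₀ (norm_nonneg _) zero_le_one, EuclideanSpace.norm_sq_eq]
  simp [Complex.normSq_eq_norm_sq]

theorem norm_toLp_eq_one_iff_real {ι : Type*} [Fintype ι] (x : ι → ℝ) :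
    ‖WithLp.toLp 2 x‖ = 1 ↔ x ⬝ᵥ x = 1 := by
  rw [← sq_eq_sq₀ (norm_nonneg _) zero_le_one, EuclideanSpace.norm_sq_eq]
  simp [dotProduct, sq]

theorem star_dotProduct_one_eq_zero_iff {ι : Type*} [Fintype ι] (x : ι → ℂ) :
    star x ⬝ᵥ 1 = 0 ↔ ∑ i, x i = 0 := by
  rw [dotProduct_one, ← star_eq_zero, star_sum]
  simp

/-- A nonzero vector can be scaled to a unit vector. -/
theorem exists_smul_star_dotProduct_self_eq_one {ι : Type*} [Fintype ι] {x : ι → ℂ} (hx : x ≠ 0) :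
    ∃ c : ℂ, star (c • x) ⬝ᵥ (c • x) = 1 := by
  have h : WithLp.toLp 2 x ≠ 0 := by simpa using hx
  refine ⟨((‖WithLp.toLp 2 x‖⁻¹ : ℝ) : ℂ), ?_⟩
  rw [← norm_toLp_eq_one_iff, WithLp.toLp_smul]
  simpa using norm_smul_inv_norm (𝕜 := ℂ) h

open scoped ComplexOrder in
/-- Normal matrices have the same eigenvectors as their adjoints. -/
theorem conjTranspose_mulVec_eq_of_isStarNormal {ι : Type*} [Fintype ι] [DecidableEq ι]
    {M : Matrix ι ι ℂ} (hM : IsStarNormal M) {v : ι → ℂ} {μ : ℂ} (h : M *ᵥ v = μ • v) :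
    Mᴴ *ᵥ v = star μ • v := by
  have hc : Mᴴ * M = M * Mᴴ := hM.star_comm_self
  have h0 : (M - μ • 1) *ᵥ v = 0 := by simp [sub_mulVec, smul_mulVec, h]
  -- A shift of a normal matrix is normal, so `M - μ` and its adjoint send `v` to vectors of equal
  -- norm, here zero.
  have hN : (M - μ • 1)ᴴ * (M - μ • 1) = (M - μ • 1) * (M - μ • 1)ᴴ := by
    simp only [conjTranspose_sub, conjTranspose_smul, conjTranspose_one, sub_mul, mul_sub, hc,
      smul_mul_assoc, mul_smul_comm, one_mul, mul_one]
    simp only [smul_sub]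
    rw [smul_comm μ (star μ)]
    abel
  have h1 : star ((M - μ • 1)ᴴ *ᵥ v) ⬝ᵥ ((M - μ • 1)ᴴ *ᵥ v) = 0 := by
    rw [star_mulVec, conjTranspose_conjTranspose, ← dotProduct_mulVec, mulVec_mulVec, ← hN,
      ← mulVec_mulVec, h0]
    simp
  have h2 := dotProduct_star_self_eq_zero.1 h1
  simpa [sub_mulVec, smul_mulVec, sub_eq_zero] using h2

open scoped ComplexOrder in
/-- A Hermitian matrix without negative eigenvalues has a nonnegative quadratic form. -/
theorem IsHermitian.re_dotProduct_mulVec_nonneg {ι : Type*} [Fintype ι] [DecidableEq ι]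
    {M : Matrix ι ι ℂ} (hM : M.IsHermitian)
    (h : ∀ (μ : ℝ) (v : ι → ℂ), v ≠ 0 → M *ᵥ v = (μ : ℂ) • v → 0 ≤ μ) (x : ι → ℂ) :
    0 ≤ (star x ⬝ᵥ M *ᵥ x).re := by
  have hp : M.PosSemidef := by
    rw [hM.posSemidef_iff_eigenvalues_nonneg]
    intro i
    refine h _ _ ?_ ((hM.mulVec_eigenvectorBasis i).trans ?_)
    · have := hM.eigenvectorBasis.orthonormal.ne_zero i
      simpa using this
    · ext; simp
  simpa using hp.re_dotProduct_nonneg x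

end Matrix

/-! ### Laplacians, numerical ranges and restricted eigenvalues -/

namespace Digraph

section Laplacian

variable {V : Type*} [Fintype V]

theorem adjMatrix_mulVec_one (R : Type*) [Ring R] (Γ : Digraph V) (i : V) :
    (Γ.adjMatrix R *ᵥ 1) i = Γ.outDegree i := by
  classical
  simp [adjMatrix, outDegree, mulVec, dotProduct, Finset.sum_boole, Set.ncard_eq_toFinset_card']

theorem adjMatrix_transpose_mulVec_one (R : Type*) [Ring R] (Γ : Digraph V) (i : V) :
    ((Γ.adjMatrix R)ᵀ *ᵥ 1) i = Γ.inDegree i := by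
  classical
  simp [adjMatrix, inDegree, mulVec, dotProduct, Finset.sum_boole, Set.ncard_eq_toFinset_card']

theorem laplacian_mulVec_apply {R : Type*} [Ring R] (Γ : Digraph V) (x : V → R) (i : V) :
    (Γ.laplacian R *ᵥ x) i = Γ.outDegree i * x i - (Γ.adjMatrix R *ᵥ x) i := by
  simp [laplacian, sub_mulVec, mulVec_diagonal]

theorem laplacian_mulVec_one (R : Type*) [Ring R] (Γ : Digraph V) :
    Γ.laplacian R *ᵥ 1 = 0 := by
  ext i
  simp [laplacian_mulVec_apply, adjMatrix_mulVec_one]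

theorem ofReal_laplacian_mulVec (Γ : Digraph V) (x : V → ℝ) (i : V) :
    ((Γ.laplacian ℝ *ᵥ x) i : ℂ) = (Γ.laplacian ℂ *ᵥ fun i => (x i : ℂ)) i := by
  classical
  rw [laplacian_mulVec_apply, laplacian_mulVec_apply]
  simp only [adjMatrix, mulVec, dotProduct, of_apply]
  push_cast
  refine congrArg _ (Finset.sum_congr rfl fun j _ => ?_)
  split_ifs <;> simp

theorem mem_restrictedNumericalRange_iff (Γ : Digraph V) (z : ℂ) :
    z ∈ Γ.restrictedNumericalRange ↔ ∃ x : V → ℂ, ∑ i, x i = 0 ∧ star x ⬝ᵥ x = 1 ∧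
      z = star x ⬝ᵥ Γ.laplacian ℂ *ᵥ x := by
  simp only [restrictedNumericalRange, Set.mem_ofPred_eq, star_dotProduct_one_eq_zero_iff,
    norm_toLp_eq_one_iff]

theorem mem_restrictedRayleighSet_iff (Γ : Digraph V) (r : ℝ) :
    r ∈ Γ.restrictedRayleighSet ↔ ∃ x : V → ℝ, ∑ i, x i = 0 ∧ x ⬝ᵥ x = 1 ∧
      r = x ⬝ᵥ Γ.laplacian ℝ *ᵥ x := by
  simp only [restrictedRayleighSet, Set.mem_ofPred_eq, dotProduct_one, norm_toLp_eq_one_iff_real]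

theorem ofReal_mem_restrictedNumericalRange {Γ : Digraph V} {r : ℝ}
    (hr : r ∈ Γ.restrictedRayleighSet) : (r : ℂ) ∈ Γ.restrictedNumericalRange := by
  obtain ⟨x, h0, h1, rfl⟩ := (mem_restrictedRayleighSet_iff _ _).1 hr
  refine (mem_restrictedNumericalRange_iff _ _).2 ⟨fun i => (x i : ℂ), ?_, ?_, ?_⟩
  · simpa using congrArg Complex.ofReal h0
  · have := congrArg (Complex.ofReal) h1
    simpa [dotProduct] using this
  · simp [dotProduct, ofReal_laplacian_mulVec]

/-- The eigenvalues of the restricted Laplacian, described without a restrictor matrix: `λ` such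
that `L x - λ x` is a constant vector for some nonzero `x` orthogonal to the all ones vector. -/
def restrictedEigenvalues (Γ : Digraph V) : Set ℂ :=
  {μ | ∃ x : V → ℂ, x ≠ 0 ∧ ∑ i, x i = 0 ∧ ∃ c : ℂ, ∀ i, (Γ.laplacian ℂ *ᵥ x) i = μ * x i + c}

/-- The constant `c` disappears from the quadratic form because `x` is orthogonal to e. -/
theorem restrictedEigenvalues_subset_restrictedNumericalRange (Γ : Digraph V) :
    Γ.restrictedEigenvalues ⊆ Γ.restrictedNumericalRange := by
  rintro μ ⟨x, hx, h0, c, hc⟩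
  obtain ⟨a, ha⟩ := exists_smul_star_dotProduct_self_eq_one hx
  have h0' : ∑ i, (a • x) i = 0 := by simp [← Finset.mul_sum, h0]
  refine (mem_restrictedNumericalRange_iff _ _).2 ⟨a • x, h0', ha, ?_⟩
  have hL : Γ.laplacian ℂ *ᵥ (a • x) = μ • (a • x) + (a * c) • (1 : V → ℂ) := by
    ext i
    simp [mulVec_smul, hc]
    ring
  rw [hL, dotProduct_add, dotProduct_smul μ, dotProduct_smul (a * c), ha,
    (star_dotProduct_one_eq_zero_iff _).2 h0']
  simp

end Laplacian

/-! ### Restrictor matrices and the spectrum of the restricted Laplacian -/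

section Restrictor

variable {V : Type*} [Fintype V] {Q : Matrix V (Fin (Fintype.card V - 1)) ℂ}

theorem IsRestrictor.exists_mulVec_eq_iff (hQ : IsRestrictor Q) (x : V → ℂ) :
    (∃ v, Q *ᵥ v = x) ↔ ∑ i, x i = 0 := by
  have h := hQ.2
  have h2 := Set.ext_iff.1 h x
  change x ∈ Submodule.span ℂ (Set.range Q.col) ↔ _ at h2
  rw [← Matrix.range_mulVecLin] at h2
  simpa [star_dotProduct_one_eq_zero_iff] using h2

theorem isRestrictor_iff : IsRestrictor Q ↔
    Qᴴ * Q = 1 ∧ ∀ x : V → ℂ, (∃ v, Q *ᵥ v = x) ↔ ∑ i, x i = 0 := by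
  refine ⟨fun h => ⟨h.1, h.exists_mulVec_eq_iff⟩, fun h => ⟨h.1, ?_⟩⟩
  ext x
  change x ∈ Submodule.span ℂ (Set.range Q.col) ↔ _
  rw [← Matrix.range_mulVecLin]
  simpa [star_dotProduct_one_eq_zero_iff] using h.2 x

theorem IsRestrictor.conjTranspose_mulVec_mulVec (hQ : IsRestrictor Q)
    (v : Fin (Fintype.card V - 1) → ℂ) : Qᴴ *ᵥ (Q *ᵥ v) = v := by
  rw [mulVec_mulVec, hQ.1, one_mulVec]

theorem IsRestrictor.mulVec_conjTranspose_mulVec (hQ : IsRestrictor Q) {x : V → ℂ}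
    (hx : ∑ i, x i = 0) : Q *ᵥ (Qᴴ *ᵥ x) = x := by
  obtain ⟨v, rfl⟩ := (hQ.exists_mulVec_eq_iff x).2 hx
  rw [hQ.conjTranspose_mulVec_mulVec]

theorem IsRestrictor.conjTranspose_mulVec_one (hQ : IsRestrictor Q) : Qᴴ *ᵥ 1 = 0 := by
  ext k
  have h := (hQ.exists_mulVec_eq_iff (Q *ᵥ Pi.single k 1)).1 ⟨_, rfl⟩
  rw [← star_dotProduct_one_eq_zero_iff] at h
  simpa [mulVec, dotProduct] using h

theorem restrictedLaplacian_mulVec (Γ : Digraph V) (Q : Matrix V (Fin (Fintype.card V - 1)) ℂ)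
    (v : Fin (Fintype.card V - 1) → ℂ) :
    Γ.restrictedLaplacian Q *ᵥ v = Qᴴ *ᵥ (Γ.laplacian ℂ *ᵥ (Q *ᵥ v)) := by
  simp [restrictedLaplacian, mulVec_mulVec, Matrix.mul_assoc]

theorem restrictedLaplacian_conjTranspose_mulVec (Γ : Digraph V)
    (Q : Matrix V (Fin (Fintype.card V - 1)) ℂ) (v : Fin (Fintype.card V - 1) → ℂ) :
    (Γ.restrictedLaplacian Q)ᴴ *ᵥ v = Qᴴ *ᵥ ((Γ.laplacian ℂ)ᴴ *ᵥ (Q *ᵥ v)) := by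
  simp [restrictedLaplacian, mulVec_mulVec, Matrix.mul_assoc, conjTranspose_mul]

theorem IsRestrictor.restrictedLaplacian_mulVec_eq (hQ : IsRestrictor Q) {Γ : Digraph V}
    {x : V → ℂ} (hx : ∑ i, x i = 0) {μ c : ℂ} (h : ∀ i, (Γ.laplacian ℂ *ᵥ x) i = μ * x i + c) :
    Γ.restrictedLaplacian Q *ᵥ (Qᴴ *ᵥ x) = μ • (Qᴴ *ᵥ x) := by
  have hL : Γ.laplacian ℂ *ᵥ x = μ • x + c • (1 : V → ℂ) := by
    ext i
    simp [h]
  rw [restrictedLaplacian_mulVec, hQ.mulVec_conjTranspose_mulVec hx, hL, mulVec_add, mulVec_smul,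
    mulVec_smul, hQ.conjTranspose_mulVec_one, smul_zero, add_zero]

/-- The kernel of `Qᴴ` consists of the constants, so an eigenvector equation for `QᴴLQ` is one for
`L` modulo constants. In particular the spectrum does not depend on `Q`. -/
theorem IsRestrictor.spectrum_restrictedLaplacian [Nonempty V] (hQ : IsRestrictor Q)
    (Γ : Digraph V) : spectrum ℂ (Γ.restrictedLaplacian Q) = Γ.restrictedEigenvalues := by
  ext μ
  rw [mem_spectrum_iff_exists_mulVec]
  constructor
  · rintro ⟨v, hv, h⟩
    refine ⟨Q *ᵥ v, fun h0 => hv ?_, (hQ.exists_mulVec_eq_iff _).1 ⟨v, rfl⟩, ?_⟩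
    · rw [← hQ.conjTranspose_mulVec_mulVec v, h0, mulVec_zero]
    set r : V → ℂ := Γ.laplacian ℂ *ᵥ (Q *ᵥ v) - μ • (Q *ᵥ v) with hr
    have hQr : Qᴴ *ᵥ r = 0 := by
      rw [hr, mulVec_sub, ← restrictedLaplacian_mulVec, h, mulVec_smul,
        hQ.conjTranspose_mulVec_mulVec, sub_self]
    -- Subtracting its mean puts the residual in the range of `Q`, while `Qᴴ` still kills it; hence
    -- it is zero.
    set c : ℂ := (∑ i, r i) / Fintype.card V with hc
    have hsum : ∑ i, (r - c • (1 : V → ℂ)) i = 0 := by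
      have : (Fintype.card V : ℂ) ≠ 0 := by simp
      simp [Finset.sum_sub_distrib, hc]
      field_simp
      ring
    have hz := hQ.mulVec_conjTranspose_mulVec hsum
    rw [mulVec_sub, hQr, mulVec_smul, hQ.conjTranspose_mulVec_one, smul_zero, sub_zero,
      mulVec_zero] at hz
    refine ⟨c, fun i => ?_⟩
    have := congrFun hz i
    simp [hr, -mulVec_mulVec] at this
    linear_combination -this
  · rintro ⟨x, hx, h0, c, hc⟩
    refine ⟨Qᴴ *ᵥ x, fun h => hx ?_, hQ.restrictedLaplacian_mulVec_eq h0 hc⟩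
    rw [← hQ.mulVec_conjTranspose_mulVec h0, h, mulVec_zero]

/-- A restricted eigenvector that is not an eigenvector of the adjoint Laplacian obstructs the
normality of the restricted Laplacian. -/
theorem IsRestrictor.not_isStarNormal_restrictedLaplacian (hQ : IsRestrictor Q) {Γ : Digraph V}
    {x : V → ℂ} (hx : ∑ i, x i = 0) {μ c : ℂ} (h : ∀ i, (Γ.laplacian ℂ *ᵥ x) i = μ * x i + c)
    (hne : (Γ.laplacian ℂ)ᴴ *ᵥ x ≠ star μ • x) : ¬ IsStarNormal (Γ.restrictedLaplacian Q) := by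
  intro hN
  have h1 := conjTranspose_mulVec_eq_of_isStarNormal hN (hQ.restrictedLaplacian_mulVec_eq hx h)
  rw [restrictedLaplacian_conjTranspose_mulVec, hQ.mulVec_conjTranspose_mulVec hx] at h1
  -- As `L` kills e, the vector `Lᴴ x` lies in e^⊥, where `Q Qᴴ` is the identity.
  have hsum : ∑ i, ((Γ.laplacian ℂ)ᴴ *ᵥ x) i = 0 := by
    rw [← star_dotProduct_one_eq_zero_iff, star_mulVec, conjTranspose_conjTranspose,
      ← dotProduct_mulVec, laplacian_mulVec_one, dotProduct_zero]
  apply hne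
  rw [← hQ.mulVec_conjTranspose_mulVec hsum, h1, mulVec_smul, hQ.mulVec_conjTranspose_mulVec hx]

end Restrictor

end Digraph

/-! ### The spectral strip and the polygonal bound -/

namespace Digraph

section Bounds

variable {V : Type*} [Fintype V]

theorem laplacian_apply_of_ne {V R : Type*} [Ring R] (Γ : Digraph V) {i j : V} (h : i ≠ j) :
    Γ.laplacian R i j = -Γ.adjMatrix R i j := by
  simp [laplacian, h]

open Classical in
theorem laplacian_apply_self {R : Type*} [Ring R] (Γ : Digraph V) (i : V) :
    Γ.laplacian R i i = ∑ j ∈ Finset.univ.erase i, Γ.adjMatrix R i j := by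
  have h := congrFun (Γ.laplacian_mulVec_one R) i
  simp only [mulVec, dotProduct_one, Pi.zero_apply] at h
  rw [← Finset.add_sum_erase _ _ (Finset.mem_univ i)] at h
  rw [eq_neg_of_add_eq_zero_left h, ← Finset.sum_neg_distrib]
  refine Finset.sum_congr rfl fun j hj => ?_
  rw [laplacian_apply_of_ne _ (Finset.ne_of_mem_erase hj).symm, neg_neg]

/-- Gershgorin: each disc is centred at a diagonal entry whose value equals the radius, so it lies
in the closed right half-plane. -/
theorem re_nonneg_of_laplacian_mulVec_eq {Γ : Digraph V} {x : V → ℂ} (hx : x ≠ 0) {μ : ℂ}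
    (h : Γ.laplacian ℂ *ᵥ x = μ • x) : 0 ≤ μ.re := by
  classical
  have he : Module.End.HasEigenvalue (toLin' (Γ.laplacian ℂ)) μ :=
    Module.End.hasEigenvalue_of_hasEigenvector (x := x)
      ⟨Module.End.mem_eigenspace_iff.2 (by simpa using h), hx⟩
  obtain ⟨k, hk⟩ := eigenvalue_mem_ball he
  have hsum : ∑ j ∈ Finset.univ.erase k, ‖Γ.laplacian ℂ k j‖ = (Γ.laplacian ℂ k k).re := by
    rw [laplacian_apply_self, Complex.re_sum]
    refine Finset.sum_congr rfl fun j hj => ?_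
    rw [laplacian_apply_of_ne _ (Finset.ne_of_mem_erase hj).symm, adjMatrix, of_apply]
    split_ifs <;> simp
  rw [hsum, mem_closedBall_iff_norm] at hk
  have := (abs_le.1 ((Complex.abs_re_le_norm _).trans hk)).1
  simp at this
  linarith

theorem re_nonneg_of_mem_restrictedEigenvalues {Γ : Digraph V} {μ : ℂ}
    (h : μ ∈ Γ.restrictedEigenvalues) : 0 ≤ μ.re := by
  obtain ⟨x, hx, h0, c, hc⟩ := h
  by_cases hμ : μ = 0
  · simp [hμ]
  -- For `μ ≠ 0` a constant shift turns a restricted eigenvector into an eigenvector of `L`. It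
  -- cannot become zero: `x` would be constant with zero sum.
  have hL : Γ.laplacian ℂ *ᵥ (x + (c / μ) • (1 : V → ℂ)) = μ • (x + (c / μ) • (1 : V → ℂ)) := by
    rw [mulVec_add, mulVec_smul, laplacian_mulVec_one]
    ext i
    simp [hc, mul_add, mul_div_cancel₀ _ hμ]
  refine re_nonneg_of_laplacian_mulVec_eq (fun hy => hx ?_) hL
  have hx' (i : V) : x i = -(c / μ) := by
    have := congrFun hy i
    simp at this
    linear_combination this
  have hs : ∑ i : V, x i = Fintype.card V * -(c / μ) := by
    simp [hx']
  rw [h0] at hs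
  ext i
  have : (Fintype.card V : ℂ) ≠ 0 := by
    have : Nonempty V := ⟨i⟩
    simp
  rw [hx' i]
  simpa [this] using hs.symm

/-- The adjacency matrices of `Γ` and `Γᶜ` add up to J. The complement of a loopless digraph has all
loops, but a loop cancels in D - A. -/
theorem laplacian_compl_mulVec_apply {Γ : Digraph V} {x : V → ℂ} (i : V) :
    (Γᶜ.laplacian ℂ *ᵥ x) i = Fintype.card V * x i - ∑ j, x j - (Γ.laplacian ℂ *ᵥ x) i := by
  have hA (x : V → ℂ) : (Γᶜ.adjMatrix ℂ *ᵥ x) i = ∑ j, x j - (Γ.adjMatrix ℂ *ᵥ x) i := by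
    rw [mulVec, mulVec, dotProduct, dotProduct, ← Finset.sum_sub_distrib]
    refine Finset.sum_congr rfl fun j _ => ?_
    simp only [adjMatrix, of_apply, compl_adj]
    by_cases h : Γ.Adj i j <;> simp [h]
  rw [laplacian_mulVec_apply, laplacian_mulVec_apply, ← adjMatrix_mulVec_one,
    ← adjMatrix_mulVec_one, hA, hA]
  simp
  ring

/-- Passing to the complement reflects `μ` to n - `μ`, which reduces the upper bound to the lower
one. -/
theorem re_le_card_of_mem_restrictedEigenvalues {Γ : Digraph V} {μ : ℂ}
    (h : μ ∈ Γ.restrictedEigenvalues) : μ.re ≤ Fintype.card V := by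
  obtain ⟨x, hx, h0, c, hc⟩ := h
  have : (Fintype.card V - μ : ℂ) ∈ Γᶜ.restrictedEigenvalues := by
    refine ⟨x, hx, h0, -c, fun i => ?_⟩
    rw [laplacian_compl_mulVec_apply, h0, hc]
    ring
  simpa using re_nonneg_of_mem_restrictedEigenvalues this

theorem IsPolygonal.laplacianSpread_le [Nontrivial V] {Γ : Digraph V} (h : Γ.IsPolygonal) :
    Γ.laplacianSpread ≤ Fintype.card V := by
  obtain ⟨Q, hQ⟩ := exists_isRestrictor V
  have hW := h.2 Q hQ
  rw [hQ.spectrum_restrictedLaplacian] at hW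
  have hconv : convexHull ℝ Γ.restrictedEigenvalues ⊆
      Complex.reLm ⁻¹' Set.Icc 0 (Fintype.card V : ℝ) :=
    convexHull_min (fun μ hμ => ⟨re_nonneg_of_mem_restrictedEigenvalues hμ,
      re_le_card_of_mem_restrictedEigenvalues hμ⟩) ((convex_Icc _ _).linear_preimage _)
  have hα := hconv (hW ▸ ofReal_mem_restrictedNumericalRange Γ.isLeast_algebraicConnectivity.1)
  have hβ := hconv (hW ▸ ofReal_mem_restrictedNumericalRange Γ.isGreatest_maxRayleigh.1)
  simp at hα hβ
  rw [laplacianSpread]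
  linarith [hα.1, hβ.2]

end Bounds

/-! ### Invariance under relabelling of the vertices -/

section Relabelling

variable {V W : Type*}

/-- The digraph obtained from `Γ` by relabelling the vertices. -/
def relabel (Γ : Digraph W) (e : V ≃ W) : Digraph V where
  Adj i j := Γ.Adj (e i) (e j)

theorem relabel_symm_relabel (Γ : Digraph W) (e : V ≃ W) :
    (Γ.relabel e).relabel e.symm = Γ := by
  ext
  simp [relabel]

theorem outDegree_relabel (Γ : Digraph W) (e : V ≃ W) (i : V) :
    (Γ.relabel e).outDegree i = Γ.outDegree (e i) := by
  rw [outDegree, outDegree, ← Set.ncard_image_of_injective _ e.injective]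
  congr 1
  ext j
  simp only [Set.mem_image, Set.mem_ofPred_eq]
  constructor
  · rintro ⟨k, hk, rfl⟩
    exact hk
  · intro hj
    exact ⟨e.symm j, by simpa [relabel] using hj, by simp⟩

theorem laplacian_relabel {R : Type*} [Ring R] (Γ : Digraph W) (e : V ≃ W) :
    (Γ.relabel e).laplacian R = (Γ.laplacian R).submatrix e e := by
  ext i j
  simp only [laplacian, Matrix.sub_apply, submatrix_apply, diagonal_apply, outDegree_relabel,
    e.injective.eq_iff]
  refine congrArg₂ _ ?_ rfl
  by_cases h : i = j <;> simp [h]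

variable [Fintype V] [Fintype W]

theorem dotProduct_laplacian_relabel_mulVec {R : Type*} [CommRing R] (Γ : Digraph W) (e : V ≃ W)
    (x y : W → R) : (x ∘ e) ⬝ᵥ (Γ.relabel e).laplacian R *ᵥ (y ∘ e) =
      x ⬝ᵥ Γ.laplacian R *ᵥ y := by
  rw [laplacian_relabel, submatrix_mulVec_equiv, comp_equiv_dotProduct_comp_equiv]
  congr
  ext
  simp

theorem restrictedNumericalRange_subset_relabel (Γ : Digraph W) (e : V ≃ W) :
    Γ.restrictedNumericalRange ⊆ (Γ.relabel e).restrictedNumericalRange := by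
  intro z hz
  obtain ⟨x, h0, h1, rfl⟩ := (mem_restrictedNumericalRange_iff _ _).1 hz
  refine (mem_restrictedNumericalRange_iff _ _).2 ⟨x ∘ e, ?_, ?_, ?_⟩
  · rw [← h0]
    exact Equiv.sum_comp e x
  · rw [← h1]
    exact comp_equiv_dotProduct_comp_equiv (star x) x e
  · exact (dotProduct_laplacian_relabel_mulVec Γ e (star x) x).symm

theorem restrictedNumericalRange_relabel (Γ : Digraph W) (e : V ≃ W) :
    (Γ.relabel e).restrictedNumericalRange = Γ.restrictedNumericalRange := by
  refine Set.Subset.antisymm ?_ (restrictedNumericalRange_subset_relabel Γ e)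
  have := restrictedNumericalRange_subset_relabel (Γ.relabel e) e.symm
  rwa [relabel_symm_relabel] at this

theorem restrictedRayleighSet_subset_relabel (Γ : Digraph W) (e : V ≃ W) :
    Γ.restrictedRayleighSet ⊆ (Γ.relabel e).restrictedRayleighSet := by
  intro z hz
  obtain ⟨x, h0, h1, rfl⟩ := (mem_restrictedRayleighSet_iff _ _).1 hz
  refine (mem_restrictedRayleighSet_iff _ _).2 ⟨x ∘ e, ?_, ?_, ?_⟩
  · rw [← h0]
    exact Equiv.sum_comp e x
  · rw [← h1]
    exact comp_equiv_dotProduct_comp_equiv x x e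
  · exact (dotProduct_laplacian_relabel_mulVec Γ e x x).symm

theorem restrictedRayleighSet_relabel (Γ : Digraph W) (e : V ≃ W) :
    (Γ.relabel e).restrictedRayleighSet = Γ.restrictedRayleighSet := by
  refine Set.Subset.antisymm ?_ (restrictedRayleighSet_subset_relabel Γ e)
  have := restrictedRayleighSet_subset_relabel (Γ.relabel e) e.symm
  rwa [relabel_symm_relabel] at this

theorem laplacianSpread_relabel (Γ : Digraph W) (e : V ≃ W) :
    (Γ.relabel e).laplacianSpread = Γ.laplacianSpread := by
  simp only [laplacianSpread, maxRayleigh, algebraicConnectivity, restrictedRayleighSet_relabel]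

theorem isStarNormal_submatrix_equiv {m n : Type*} [Fintype m] [Fintype n] {M : Matrix n n ℂ}
    (e : m ≃ n) (h : IsStarNormal (M.submatrix e e)) : IsStarNormal M := by
  refine ⟨?_⟩
  change Mᴴ * M = M * Mᴴ
  have h1 := h.star_comm_self.eq
  simp only [star_eq_conjTranspose, conjTranspose_submatrix, submatrix_mul_equiv] at h1
  have h2 := congrArg (fun N => N.submatrix e.symm e.symm) h1
  simpa using h2

/-- Restrictor matrices of a relabelled digraph come from restrictor matrices of the digraph. -/
theorem IsRestrictor.exists_relabel {Q : Matrix V (Fin (Fintype.card V - 1)) ℂ}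
    (hQ : IsRestrictor Q) (e : V ≃ W) :
    ∃ (Q' : Matrix W (Fin (Fintype.card W - 1)) ℂ)
      (c : Fin (Fintype.card V - 1) ≃ Fin (Fintype.card W - 1)), IsRestrictor Q' ∧
      ∀ Γ : Digraph W, (Γ.relabel e).restrictedLaplacian Q =
        (Γ.restrictedLaplacian Q').submatrix c c := by
  -- The two column index types agree only through the equality of cardinalities.
  let c : Fin (Fintype.card V - 1) ≃ Fin (Fintype.card W - 1) :=
    finCongr (by rw [Fintype.card_congr e])
  refine ⟨Q.submatrix e.symm c.symm, c, isRestrictor_iff.2 ⟨?_, fun x => ?_⟩, fun Γ => ?_⟩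
  · rw [conjTranspose_submatrix, submatrix_mul_equiv, hQ.1, submatrix_one_equiv]
  · have hx : ∑ i, x i = ∑ i, (x ∘ e) i := (Equiv.sum_comp e x).symm
    rw [hx, ← hQ.exists_mulVec_eq_iff]
    constructor
    · rintro ⟨v, rfl⟩
      refine ⟨v ∘ c, ?_⟩
      rw [submatrix_mulVec_equiv]
      ext
      simp
    · rintro ⟨v, hv⟩
      refine ⟨v ∘ c.symm, ?_⟩
      rw [submatrix_mulVec_equiv]
      ext i
      have := congrFun hv (e.symm i)
      simpa [Function.comp_assoc] using this
  · simp only [restrictedLaplacian, laplacian_relabel]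
    ext k l
    simp [Matrix.mul_apply, ← Equiv.sum_comp e]

theorem IsPseudoNormal.relabel {Γ : Digraph W} (h : Γ.IsPseudoNormal) (e : V ≃ W) :
    (Γ.relabel e).IsPseudoNormal where
  isPolygonal := by
    refine ⟨fun v => h.isPolygonal.1 (e v), fun Q hQ => ?_⟩
    obtain ⟨Q', c, hQ', hL⟩ := hQ.exists_relabel e
    rw [restrictedNumericalRange_relabel, h.isPolygonal.2 Q' hQ', hL,
      ← AlgEquiv.spectrum_eq (reindexAlgEquiv ℂ ℂ c.symm) (Γ.restrictedLaplacian Q')]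
    rfl
  not_normal hN := by
    rw [laplacian_relabel] at hN
    exact h.not_normal (isStarNormal_submatrix_equiv e hN)
  not_restricted_normal Q hQ hN := by
    obtain ⟨Q', c, hQ', hL⟩ := hQ.exists_relabel e
    rw [hL] at hN
    exact h.not_restricted_normal Q' hQ' (isStarNormal_submatrix_equiv c hN)

end Relabelling

end Digraph

/-! ### Cotangent estimates -/

namespace Real

/-- `x ↦ x cot x` is at least its value at `π / 6` on `(0, π / 6]`. -/
theorem sqrt_three_mul_pi_mul_sin_le {x : ℝ} (h0 : 0 ≤ x) (h1 : x ≤ π / 6) :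
    √3 * π * sin x ≤ 6 * (x * cos x) := by
  have h3 : √3 * √3 = 3 := Real.mul_self_sqrt (by norm_num)
  have hd (y : ℝ) : HasDerivAt (fun x => 6 * (x * cos x) - √3 * π * sin x)
      (6 * (cos y - y * sin y) - √3 * π * cos y) y := by
    refine ((((hasDerivAt_id y).mul (hasDerivAt_cos y)).const_mul 6).sub
      ((hasDerivAt_sin y).const_mul (√3 * π))).congr_deriv ?_
    simp only [id]
    ring
  have hd2 (y : ℝ) : HasDerivAt (fun y => 6 * (cos y - y * sin y) - √3 * π * cos y)
      (6 * (-sin y - (sin y + y * cos y)) + √3 * π * sin y) y := by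
    refine ((((hasDerivAt_cos y).sub ((hasDerivAt_id y).mul (hasDerivAt_sin y))).const_mul 6).sub
      ((hasDerivAt_cos y).const_mul (√3 * π))).congr_deriv ?_
    simp only [id]
    ring
  -- The difference of the two sides is concave and vanishes at both 0 and π/6, so it is nonnegative
  -- in between.
  have hf : ConcaveOn ℝ (Set.Icc 0 (π / 6)) (fun x => 6 * (x * cos x) - √3 * π * sin x) := by
    have hd' : deriv (fun x => 6 * (x * cos x) - √3 * π * sin x) =
        fun y => 6 * (cos y - y * sin y) - √3 * π * cos y := funext fun y => (hd y).deriv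
    refine concaveOn_of_deriv2_nonpos (convex_Icc _ _)
      (fun y _ => (hd y).continuousAt.continuousWithinAt)
      (fun y _ => (hd y).differentiableAt.differentiableWithinAt) ?_ ?_
    · rw [hd']
      exact fun y _ => (hd2 y).differentiableAt.differentiableWithinAt
    · intro y hy
      rw [interior_Icc] at hy
      have : deriv^[2] (fun x => 6 * (x * cos x) - √3 * π * sin x) y =
          6 * (-sin y - (sin y + y * cos y)) + √3 * π * sin y := by
        simp only [Function.iterate_succ, Function.iterate_zero, Function.comp_apply, id, hd']
        exact (hd2 y).deriv
      rw [this]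
      have hs : 0 ≤ sin y := sin_nonneg_of_nonneg_of_le_pi hy.1.le (by linarith [hy.2, pi_pos])
      have hc : 0 ≤ cos y := cos_nonneg_of_neg_pi_div_two_le_of_le
        (by linarith [hy.1, pi_pos]) (by linarith [hy.2, pi_pos])
      have hk : √3 * π ≤ 12 := by
        nlinarith [pi_lt_four, pi_pos, Real.sqrt_nonneg 3]
      have := mul_nonneg hy.1.le hc
      nlinarith
  have hpi : (0:ℝ) < π / 6 := by positivity
  have hmem : x ∈ segment ℝ 0 (π / 6) := by
    rw [segment_eq_Icc hpi.le]
    exact ⟨h0, h1⟩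
  have := hf.ge_on_segment (Set.left_mem_Icc.2 hpi.le) (Set.right_mem_Icc.2 hpi.le) hmem
  rw [sin_pi_div_six, cos_pi_div_six] at this
  have h2 : min (6 * ((0:ℝ) * cos 0) - √3 * π * sin 0) (6 * (π / 6 * (√3 / 2)) - √3 * π * (1 / 2))
    = 0 := by
    have : 6 * (π / 6 * (√3 / 2)) - √3 * π * (1 / 2) = 0 := by ring
    rw [this]
    simp
  rw [h2] at this
  linarith

/-- This lower bound and positivity are all that the inclusion in the quadrilateral needs to know
about the value of the cotangent. It is an equality for p = 3. -/
theorem sq_div_twelve_le_sq_half_cot {p : ℝ} (hp : 3 ≤ p) :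
    p ^ 2 / 12 ≤ (1 / 2 * cot (π / (2 * p))) ^ 2 := by
  have hp0 : 0 < p := by linarith
  have hx0 : 0 < π / (2 * p) := by positivity
  have hx1 : π / (2 * p) ≤ π / 6 := by
    gcongr
    linarith
  have h := sqrt_three_mul_pi_mul_sin_le hx0.le hx1
  have hs : 0 < sin (π / (2 * p)) := sin_pos_of_pos_of_lt_pi hx0 (by linarith [pi_pos])
  have hcot : √3 * p / 3 ≤ cot (π / (2 * p)) := by
    rw [cot_eq_cos_div_sin, le_div_iff₀ hs]
    have : 6 * (π / (2 * p) * cos (π / (2 * p))) = 3 * π * cos (π / (2 * p)) / p := by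
      field_simp
      ring
    rw [this, le_div_iff₀ hp0] at h
    have h' : π * (√3 * p * sin (π / (2 * p))) ≤ π * (3 * cos (π / (2 * p))) := by linarith
    have := le_of_mul_le_mul_left h' pi_pos
    linarith
  have h3 : √3 ^ 2 = 3 := Real.sq_sqrt (by norm_num)
  have := pow_le_pow_left₀ (by positivity) hcot 2
  rw [div_pow, mul_pow, h3] at this
  linarith

theorem half_cot_pos {p : ℝ} (hp : 3 ≤ p) : 0 < 1 / 2 * cot (π / (2 * p)) := by
  have hp0 : 0 < p := by linarith
  have hx0 : 0 < π / (2 * p) := by positivity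
  have hx1 : π / (2 * p) < π / 2 := by
    gcongr
    linarith
  rw [cot_eq_cos_div_sin]
  have h1 : 0 < sin (π / (2 * p)) := sin_pos_of_pos_of_lt_pi hx0 (by linarith [pi_pos])
  have h2 : 0 < cos (π / (2 * p)) := cos_pos_of_mem_Ioo ⟨by linarith [pi_pos], hx1⟩
  positivity

end Real

/-! ### The rotational tournament and its spectrum -/

theorem Real.sum_sin_mul_two_mul_sin_half (m : ℕ) (φ : ℝ) :
    (∑ s ∈ Finset.range m, Real.sin (2 * (s + 1) * φ)) * (2 * Real.sin φ) =
      Real.cos φ - Real.cos ((2 * m + 1) * φ) := by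
  induction m with
  | zero => simp
  | succ m ih =>
    rw [Finset.sum_range_succ, add_mul, ih]
    -- The product of sines is a difference of cosines, so the sum telescopes.
    have h := Real.cos_sub_cos ((2 * m + 1) * φ) ((2 * (m + 1 : ℕ) + 1) * φ)
    have h1 : ((2 * m + 1) * φ + (2 * (m + 1 : ℕ) + 1) * φ) / 2 = 2 * (m + 1) * φ := by
      push_cast
      ring
    have h2 : ((2 * m + 1) * φ - (2 * (m + 1 : ℕ) + 1) * φ) / 2 = -φ := by
      push_cast
      ring
    rw [h1, h2, Real.sin_neg] at h
    linarith

namespace Digraph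

/-- The rotational tournament on `ℤ/(2m+1)`: there is an edge from `i` to each of
`i + 1, …, i + m`. -/
def rotational (m : ℕ) : Digraph (ZMod (2 * m + 1)) where
  Adj i j := 1 ≤ (j - i).val ∧ (j - i).val ≤ m

section Rotational

variable {m : ℕ}

theorem ncard_setOf_val_mem :
    {d : ZMod (2 * m + 1) | 1 ≤ d.val ∧ d.val ≤ m}.ncard = m := by
  rw [← Set.ncard_image_of_injective _ (ZMod.val_injective (2 * m + 1))]
  have : ZMod.val '' {d : ZMod (2 * m + 1) | 1 ≤ d.val ∧ d.val ≤ m} = (Finset.Icc 1 m : Set ℕ) := by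
    ext s
    simp only [Set.mem_image, Set.mem_ofPred_eq, Finset.coe_Icc, Set.mem_Icc]
    constructor
    · rintro ⟨d, hd, rfl⟩
      exact hd
    · intro hs
      have : (s : ZMod (2 * m + 1)).val = s := ZMod.val_natCast_of_lt (by omega)
      exact ⟨s, by rwa [this], this⟩
  rw [this, Set.ncard_coe_finset]
  simp

theorem outDegree_rotational (i : ZMod (2 * m + 1)) : (rotational m).outDegree i = m := by
  refine Eq.trans ?_ ncard_setOf_val_mem
  rw [← Set.ncard_image_of_injective _ (add_left_injective i), outDegree]
  congr 1
  ext j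
  constructor
  · intro h
    exact ⟨j - i, h, by simp⟩
  · rintro ⟨d, h, rfl⟩
    simpa [rotational] using h

theorem inDegree_rotational (i : ZMod (2 * m + 1)) : (rotational m).inDegree i = m := by
  refine Eq.trans ?_ ncard_setOf_val_mem
  rw [← Set.ncard_image_of_injective _ (sub_right_injective (b := i)), inDegree]
  congr 1
  ext j
  constructor
  · intro h
    exact ⟨i - j, h, by simp⟩
  · rintro ⟨d, h, rfl⟩
    simpa [rotational] using h

theorem isTournament_rotational : (rotational m).IsTournament := by
  refine ⟨fun i => by simp [rotational], fun i j hij => ?_⟩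
  have h0 : j - i ≠ 0 := sub_ne_zero.2 hij.symm
  have h1 : (j - i).val ≠ 0 := by rwa [Ne, ZMod.val_eq_zero]
  have h2 := ZMod.val_lt (j - i)
  have h3 : (i - j).val = 2 * m + 1 - (j - i).val := by
    rw [← neg_sub, ZMod.neg_val, if_neg h0]
  simp only [rotational, h3]
  omega

theorem isRegularTournament_rotational (hm : 1 ≤ m) : (rotational m).IsRegularTournament where
  isTournament := isTournament_rotational
  three_le := by
    rw [ZMod.card]
    omega
  odd := by
    rw [ZMod.card]
    exact odd_two_mul_add_one m
  outDegree_eq i := by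
    rw [outDegree_rotational, ZMod.card]
    omega
  inDegree_eq i := by
    rw [inDegree_rotational, ZMod.card]
    omega

/-- The eigenvalue of the rotational tournament for the character of frequency `k`. -/
noncomputable def rotationalEigenvalue (m : ℕ) (k : ZMod (2 * m + 1)) : ℂ :=
  ∑ s ∈ Finset.range m, ZMod.stdAddChar (((s + 1 : ℕ) : ZMod (2 * m + 1)) * k)

theorem adjMatrix_rotational_mulVec (v : ZMod (2 * m + 1) → ℂ) (i : ZMod (2 * m + 1)) :
    ((rotational m).adjMatrix ℂ *ᵥ v) i = ∑ s ∈ Finset.range m, v (i + (s + 1 : ℕ)) := by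
  classical
  simp only [adjMatrix, mulVec, dotProduct, of_apply, ite_mul, one_mul, zero_mul]
  rw [← Finset.sum_filter]
  symm
  have hval (s : ℕ) (hs : s ∈ Finset.range m) :
      ((s + 1 : ℕ) : ZMod (2 * m + 1)).val = s + 1 :=
    ZMod.val_natCast_of_lt (by simp at hs; omega)
  refine Finset.sum_bij (fun s _ => i + (s + 1 : ℕ)) ?_ ?_ ?_ (fun _ _ => rfl)
  · intro s hs
    have := hval s hs
    refine Finset.mem_filter.2 ⟨Finset.mem_univ _, ?_⟩
    change 1 ≤ (i + ((s + 1 : ℕ) : ZMod (2 * m + 1)) - i).val ∧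
      (i + ((s + 1 : ℕ) : ZMod (2 * m + 1)) - i).val ≤ m
    rw [add_sub_cancel_left, this]
    exact ⟨by omega, Finset.mem_range.1 hs⟩
  · intro s hs s' hs' h
    have h' := congrArg ZMod.val (add_left_cancel h)
    rw [hval s hs, hval s' hs'] at h'
    omega
  · intro j hj
    have hj : 1 ≤ (j - i).val ∧ (j - i).val ≤ m := (Finset.mem_filter.1 hj).2
    refine ⟨(j - i).val - 1, Finset.mem_range.2 (by omega), ?_⟩
    rw [Nat.sub_add_cancel hj.1, ZMod.natCast_zmod_val]
    ring

theorem rotationalEigenvalue_mem_spectrum {_ : DecidableEq (ZMod (2 * m + 1))}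
    (k : ZMod (2 * m + 1)) :
    rotationalEigenvalue m k ∈ spectrum ℂ ((rotational m).adjMatrix ℂ) := by
  rw [mem_spectrum_iff_exists_mulVec]
  refine ⟨fun j => ZMod.stdAddChar (j * k), fun h => ?_, ?_⟩
  · have := congrFun h 0
    simp at this
  · ext i
    simp only [adjMatrix_rotational_mulVec, rotationalEigenvalue, Pi.smul_apply, smul_eq_mul,
      Finset.sum_mul, add_mul, AddChar.map_add_eq_mul]
    exact Finset.sum_congr rfl fun _ _ => mul_comm _ _

/-- The discrete Fourier transform diagonalises the circulant, and an eigenvector has some nonzero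
Fourier coefficient; its frequency gives the eigenvalue. -/
theorem exists_eq_rotationalEigenvalue {_ : DecidableEq (ZMod (2 * m + 1))} {μ : ℂ}
    (h : μ ∈ spectrum ℂ ((rotational m).adjMatrix ℂ)) : ∃ k, μ = rotationalEigenvalue m k := by
  obtain ⟨v, hv, hμ⟩ := mem_spectrum_iff_exists_mulVec.1 h
  have hdft : ZMod.dft v ≠ 0 := by simpa using hv
  obtain ⟨k, hk⟩ := Function.ne_iff.1 hdft
  refine ⟨k, mul_right_cancel₀ hk ?_⟩
  have h1 : ZMod.dft ((rotational m).adjMatrix ℂ *ᵥ v) k = rotationalEigenvalue m k *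
      ZMod.dft v k := by
    rw [ZMod.dft_apply, ZMod.dft_apply, rotationalEigenvalue, Finset.sum_mul]
    simp only [adjMatrix_rotational_mulVec, smul_eq_mul, Finset.mul_sum]
    rw [Finset.sum_comm]
    refine Finset.sum_congr rfl fun s _ => ?_
    refine Fintype.sum_equiv (Equiv.addRight ((s + 1 : ℕ) : ZMod (2 * m + 1))) _ _ fun j => ?_
    rw [Equiv.coe_addRight, ← mul_assoc, ← AddChar.map_add_eq_mul]
    congr 2
    ring
  rw [← h1, hμ, map_smul]
  rfl

theorem rotationalEigenvalue_im (k : ZMod (2 * m + 1)) :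
    (rotationalEigenvalue m k).im * (2 * Real.sin (k.val * (Real.pi / (2 * m + 1)))) =
      Real.cos (k.val * (Real.pi / (2 * m + 1))) - Real.cos (k.val * Real.pi) := by
  have h : (rotationalEigenvalue m k).im =
      ∑ s ∈ Finset.range m, Real.sin (2 * (s + 1) * (k.val * (Real.pi / (2 * m + 1)))) := by
    rw [rotationalEigenvalue, Complex.im_sum]
    refine Finset.sum_congr rfl fun s _ => ?_
    have : ((s + 1 : ℕ) : ZMod (2 * m + 1)) * k = (((s + 1) * k.val : ℕ) : ℤ) := by
      push_cast
      rw [ZMod.natCast_zmod_val]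
    rw [this, ZMod.stdAddChar_coe]
    rw [← Complex.exp_ofReal_mul_I_im]
    congr 2
    push_cast
    ring
  rw [h, Real.sum_sin_mul_two_mul_sin_half]
  congr 2
  field_simp

theorem half_cot_mul_two_mul_sin {x : ℝ} (hx : Real.sin (x / 2) ≠ 0) :
    1 / 2 * Real.cot (x / 2) * (2 * Real.sin x) = Real.cos x + 1 := by
  have h1 : Real.sin x = 2 * Real.sin (x / 2) * Real.cos (x / 2) := by
    rw [← Real.sin_two_mul]
    ring_nf
  have h2 : Real.cos x = 2 * Real.cos (x / 2) ^ 2 - 1 := by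
    rw [← Real.cos_two_mul]
    ring_nf
  rw [h1, h2, Real.cot_eq_cos_div_sin]
  field_simp
  ring

/-- With φ = π/(2m+1), the imaginary part is (cos kφ - cos kπ)/(2 sin kφ). For k ≠ 0 the angle kφ
lies in [φ, π - φ], so the numerator is at most 1 + cos φ in absolute value and sin kφ ≥ sin φ. The
resulting quotient is cot(φ/2)/2, attained at k = 1. -/
theorem abs_rotationalEigenvalue_im_le (hm : 1 ≤ m) (k : ZMod (2 * m + 1)) :
    |(rotationalEigenvalue m k).im| ≤ 1 / 2 * Real.cot (Real.pi / (2 * m + 1) / 2) := by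
  have hm' : (1 : ℝ) ≤ m := by exact_mod_cast hm
  have hpi := Real.pi_pos
  have hp : (3:ℝ) ≤ 2 * m + 1 := by linarith
  have ha0 : 0 < Real.pi / (2 * m + 1) := by positivity
  have ha1 : Real.pi / (2 * m + 1) ≤ Real.pi / 3 := by gcongr
  set a := Real.pi / (2 * m + 1) with ha
  have hsa2 : 0 < Real.sin (a / 2) := Real.sin_pos_of_pos_of_lt_pi (by linarith) (by linarith)
  have hca2 : 0 < Real.cos (a / 2) := Real.cos_pos_of_mem_Ioo ⟨by linarith, by linarith⟩
  have hC : 0 ≤ 1 / 2 * Real.cot (a / 2) := by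
    rw [Real.cot_eq_cos_div_sin]
    positivity
  by_cases hk : k = 0
  · subst hk
    simpa [rotationalEigenvalue] using hC
  have hk1 : (1:ℝ) ≤ k.val := by
    exact_mod_cast Nat.one_le_iff_ne_zero.2 (by rwa [Ne, ZMod.val_eq_zero])
  have hk2 : (k.val : ℝ) ≤ 2 * m := by
    exact_mod_cast Nat.lt_succ_iff.1 (ZMod.val_lt k)
  have hapi : (2 * m + 1) * a = Real.pi := by
    rw [ha]
    field_simp
  have h1 : a ≤ k.val * a := by nlinarith
  have h2 : k.val * a ≤ Real.pi - a := by nlinarith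
  have hcos1 : Real.cos (k.val * a) ≤ Real.cos a :=
    Real.cos_le_cos_of_nonneg_of_le_pi ha0.le (by linarith) h1
  have hcos2 : -Real.cos a ≤ Real.cos (k.val * a) := by
    rw [← Real.cos_pi_sub]
    exact Real.cos_le_cos_of_nonneg_of_le_pi (by linarith) (by linarith) h2
  have hsin0 : 0 < Real.sin a := Real.sin_pos_of_pos_of_lt_pi ha0 (by linarith)
  have hsin : Real.sin a ≤ Real.sin (k.val * a) := by
    rcases le_total (k.val * a) (Real.pi / 2) with h | h
    · exact Real.sin_le_sin_of_le_of_le_pi_div_two (by linarith) h h1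
    · rw [← Real.sin_pi_sub (k.val * a)]
      exact Real.sin_le_sin_of_le_of_le_pi_div_two (by linarith) (by linarith) (by linarith)
  have hmain := rotationalEigenvalue_im k
  rw [← ha] at hmain
  have hCa := half_cot_mul_two_mul_sin hsa2.ne'
  have hpos : 0 < 2 * Real.sin (k.val * a) := by linarith
  refine le_of_mul_le_mul_right ?_ hpos
  calc |(rotationalEigenvalue m k).im| * (2 * Real.sin (k.val * a))
      = |Real.cos (k.val * a) - Real.cos (k.val * Real.pi)| := by
        rw [← hmain, abs_mul, abs_of_pos hpos]
    _ ≤ |Real.cos (k.val * a)| + |Real.cos (k.val * Real.pi)| := abs_sub _ _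
    _ ≤ Real.cos a + 1 := add_le_add (abs_le.2 ⟨hcos2, hcos1⟩) (Real.abs_cos_le_one _)
    _ = 1 / 2 * Real.cot (a / 2) * (2 * Real.sin a) := hCa.symm
    _ ≤ _ := by gcongr

theorem rotationalEigenvalue_one_im (hm : 1 ≤ m) :
    (rotationalEigenvalue m 1).im = 1 / 2 * Real.cot (Real.pi / (2 * m + 1) / 2) := by
  have hpi := Real.pi_pos
  have hp : (3:ℝ) ≤ 2 * m + 1 := by
    have hm' : (1 : ℝ) ≤ m := by exact_mod_cast hm
    linarith
  have ha0 : 0 < Real.pi / (2 * m + 1) := by positivity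
  have ha1 : Real.pi / (2 * m + 1) ≤ Real.pi / 3 := by gcongr
  have h := rotationalEigenvalue_im (m := m) 1
  have hv : (1 : ZMod (2 * m + 1)).val = 1 := by
    have := ZMod.val_natCast_of_lt (n := 2 * m + 1) (a := 1) (by omega)
    simpa using this
  rw [hv, Nat.cast_one, one_mul, one_mul, Real.cos_pi, sub_neg_eq_add] at h
  rw [← half_cot_mul_two_mul_sin (Real.sin_pos_of_pos_of_lt_pi (by linarith) (by linarith)).ne'] at h
  exact mul_right_cancel₀ (mul_pos two_pos
    (Real.sin_pos_of_pos_of_lt_pi ha0 (by linarith))).ne' h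

theorem rotationalEigenvalue_neg (k : ZMod (2 * m + 1)) :
    rotationalEigenvalue m (-k) = star (rotationalEigenvalue m k) := by
  simp only [rotationalEigenvalue, star_sum, mul_neg]
  refine Finset.sum_congr rfl fun s _ => ?_
  rw [AddChar.map_neg_eq_conj]
  rfl

theorem isRegularPickTournament_rotational (hm : 1 ≤ m) :
    (rotational m).IsRegularPickTournament := by
  have hC : 1 / 2 * Real.cot (Real.pi / (2 * m + 1) / 2) =
      1 / 2 * Real.cot (Real.pi / (2 * Fintype.card (ZMod (2 * m + 1)))) := by
    rw [ZMod.card, div_div]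
    push_cast
    ring_nf
  refine ⟨isRegularTournament_rotational hm, ⟨?_, ?_⟩, ⟨?_, ?_⟩⟩ <;> rw [← hC]
  · exact ⟨_, rotationalEigenvalue_mem_spectrum 1, rotationalEigenvalue_one_im hm⟩
  · rintro _ ⟨μ, hμ, rfl⟩
    obtain ⟨k, rfl⟩ := exists_eq_rotationalEigenvalue hμ
    exact (abs_le.1 (abs_rotationalEigenvalue_im_le hm k)).2
  · refine ⟨_, rotationalEigenvalue_mem_spectrum (-1), ?_⟩
    rw [rotationalEigenvalue_neg, ← rotationalEigenvalue_one_im hm]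
    rfl
  · rintro _ ⟨μ, hμ, rfl⟩
    obtain ⟨k, rfl⟩ := exists_eq_rotationalEigenvalue hμ
    exact (abs_le.1 (abs_rotationalEigenvalue_im_le hm k)).1

theorem exists_isRegularPickTournament {p : ℕ} (hp : 3 ≤ p) (hodd : Odd p) :
    ∃ T : Digraph (Fin p), T.IsRegularPickTournament := by
  obtain ⟨m, rfl⟩ := hodd
  -- `ZMod (2 * m + 1)` unfolds to `Fin (2 * m + 1)`.
  exact ⟨rotational m, isRegularPickTournament_rotational (m := m) (by omega)⟩

end Rotational

end Digraph

/-! ### Laplacians of directed joins -/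

namespace Digraph

section JoinLaplacian

variable {V W R : Type*} [Fintype V] [Fintype W] [CommRing R]

theorem adjMatrix_directedJoin {V W R : Type*} [CommRing R] (Γ₁ : Digraph V) (Γ₂ : Digraph W) :
    (Γ₁.directedJoin Γ₂).adjMatrix R =
      fromBlocks (Γ₁.adjMatrix R) (of fun _ _ => 1) 0 (Γ₂.adjMatrix R) := by
  ext (i | i) (j | j) <;> simp [adjMatrix, directedJoin] <;> congr

theorem laplacian_directedJoin_mulVec (Γ₁ : Digraph V) (Γ₂ : Digraph W) (x : V → R) (y : W → R) :
    (Γ₁.directedJoin Γ₂).laplacian R *ᵥ Sum.elim x y =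
      Sum.elim (fun i => (Γ₁.laplacian R *ᵥ x) i + Fintype.card W * x i - ∑ j, y j)
        (Γ₂.laplacian R *ᵥ y) := by
  have h1 : (1 : V ⊕ W → R) = Sum.elim (1 : V → R) (1 : W → R) := by
    ext (i | i) <;> simp
  have h2 (y : W → R) (i : V) : ((of fun _ _ => (1 : R)) *ᵥ y) i = ∑ j, y j := by
    simp [mulVec, dotProduct]
  ext (i | i)
  · rw [laplacian_mulVec_apply, ← adjMatrix_mulVec_one, adjMatrix_directedJoin, h1,
      fromBlocks_mulVec, fromBlocks_mulVec]
    simp only [Sum.elim_inl, Sum.elim_comp_inl, Sum.elim_comp_inr, Pi.add_apply, h2,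
      laplacian_mulVec_apply, adjMatrix_mulVec_one]
    simp
    ring
  · rw [laplacian_mulVec_apply, ← adjMatrix_mulVec_one, adjMatrix_directedJoin, h1,
      fromBlocks_mulVec, fromBlocks_mulVec]
    simp [laplacian_mulVec_apply, adjMatrix_mulVec_one]

theorem laplacian_complete_mulVec_apply (x : V → R) (i : V) :
    ((complete V).laplacian R *ᵥ x) i = Fintype.card V * x i - ∑ j, x j := by
  classical
  have hA (x : V → R) : ((complete V).adjMatrix R *ᵥ x) i = ∑ j, x j - x i := by
    have : ∑ j, (if i = j then x j else 0) = x i := by simp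
    rw [← this, ← Finset.sum_sub_distrib, mulVec, dotProduct]
    refine Finset.sum_congr rfl fun j _ => ?_
    by_cases h : i = j <;> simp [adjMatrix, complete, h]
  rw [laplacian_mulVec_apply, ← adjMatrix_mulVec_one, hA, hA]
  simp
  ring

theorem laplacian_emptyDigraph_mulVec (x : V → R) :
    (Digraph.emptyDigraph V).laplacian R *ᵥ x = 0 := by
  have hA (x : V → R) (i : V) : ((Digraph.emptyDigraph V).adjMatrix R *ᵥ x) i = 0 := by
    simp [adjMatrix, mulVec, dotProduct]
  ext i
  rw [laplacian_mulVec_apply, ← adjMatrix_mulVec_one, hA, hA]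
  simp

end JoinLaplacian

/-! ### Adjacency forms of regular tournaments -/

section Tournament

variable {V : Type*} [Fintype V] {T : Digraph V}

theorem conjTranspose_adjMatrix {V : Type*} (Γ : Digraph V) : (Γ.adjMatrix ℂ)ᴴ = (Γ.adjMatrix ℂ)ᵀ := by
  ext i j
  simp only [conjTranspose_apply, transpose_apply, adjMatrix, of_apply]
  split_ifs <;> simp

/-- This is A + Aᵀ = J - I. It fixes the real part of the quadratic form of A and makes Aᵀ equal to
-I - A on e^⊥. -/
theorem IsTournament.adjMatrix_transpose_mulVec (hT : T.IsTournament) (x : V → ℂ) (i : V) :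
    ((T.adjMatrix ℂ)ᵀ *ᵥ x) i = ∑ j, x j - x i - (T.adjMatrix ℂ *ᵥ x) i := by
  classical
  have : ∑ j, (if i = j then x j else 0) = x i := by simp
  rw [← this, mulVec, mulVec, dotProduct, dotProduct, ← Finset.sum_sub_distrib,
    ← Finset.sum_sub_distrib]
  refine Finset.sum_congr rfl fun j _ => ?_
  by_cases hij : i = j
  · subst hij
    simp [adjMatrix, hT.1 i]
  · have := hT.2 i j hij
    by_cases h : T.Adj j i <;> simp [adjMatrix, this, h, hij]

theorem IsRegularTournament.cast_half_card_sub_one (hT : T.IsRegularTournament) :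
    (((Fintype.card V - 1) / 2 : ℕ) : ℂ) = (Fintype.card V - 1) / 2 := by
  obtain ⟨m, hm⟩ := hT.odd
  rw [hm]
  simp

theorem IsRegularTournament.laplacian_mulVec_apply (hT : T.IsRegularTournament) (x : V → ℂ)
    (i : V) : (T.laplacian ℂ *ᵥ x) i =
      (Fintype.card V - 1) / 2 * x i - (T.adjMatrix ℂ *ᵥ x) i := by
  rw [Digraph.laplacian_mulVec_apply, hT.outDegree_eq, hT.cast_half_card_sub_one]

theorem IsRegularTournament.sum_adjMatrix_mulVec (hT : T.IsRegularTournament) (x : V → ℂ) :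
    ∑ i, (T.adjMatrix ℂ *ᵥ x) i = (Fintype.card V - 1) / 2 * ∑ i, x i := by
  rw [← one_dotProduct, dotProduct_mulVec, ← mulVec_transpose]
  have : (T.adjMatrix ℂ)ᵀ *ᵥ 1 = ((Fintype.card V - 1) / 2 : ℂ) • (1 : V → ℂ) := by
    ext i
    rw [adjMatrix_transpose_mulVec_one, hT.inDegree_eq, hT.cast_half_card_sub_one]
    simp
  rw [this, smul_dotProduct, one_dotProduct, smul_eq_mul]

theorem star_dotProduct_adjMatrix_transpose_mulVec (Γ : Digraph V) (x y : V → ℂ) :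
    star x ⬝ᵥ (Γ.adjMatrix ℂ)ᵀ *ᵥ y = star (star y ⬝ᵥ Γ.adjMatrix ℂ *ᵥ x) := by
  rw [← conjTranspose_adjMatrix, dotProduct_mulVec, ← star_mulVec, star_dotProduct]

theorem IsTournament.re_star_dotProduct_adjMatrix_mulVec (hT : T.IsTournament) (x : V → ℂ) :
    (star x ⬝ᵥ T.adjMatrix ℂ *ᵥ x).re =
      (Complex.normSq (∑ i, x i) - ∑ i, Complex.normSq (x i)) / 2 := by
  have h1 : (T.adjMatrix ℂ)ᵀ *ᵥ x = (∑ j, x j) • (1 : V → ℂ) - x - T.adjMatrix ℂ *ᵥ x := by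
    ext i
    simp [hT.adjMatrix_transpose_mulVec]
  have h2 := star_dotProduct_adjMatrix_transpose_mulVec T x x
  rw [h1, dotProduct_sub, dotProduct_sub, dotProduct_smul, dotProduct_one,
    star_dotProduct_self_eq_sum] at h2
  have h3 : (∑ j, x j) • ∑ i, star x i = ((Complex.normSq (∑ i, x i) : ℝ) : ℂ) := by
    rw [Complex.normSq_eq_conj_mul_self, map_sum, smul_eq_mul, mul_comm]
    rfl
  rw [h3] at h2
  have := congrArg Complex.re h2
  simp only [Complex.sub_re, Complex.ofReal_re, Complex.star_def, Complex.conj_re] at this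
  linarith

/-- An eigenvalue of the adjacency matrix of a regular tournament that is not real has real part
`-1/2`, with an eigenvector orthogonal to the all ones vector. -/
theorem IsRegularTournament.exists_eigenvector [DecidableEq V] (hT : T.IsRegularTournament) {μ : ℂ}
    (hμ : μ ∈ spectrum ℂ (T.adjMatrix ℂ)) (him : μ.im ≠ 0) :
    ∃ v : V → ℂ, ∑ i, v i = 0 ∧ star v ⬝ᵥ v = 1 ∧
      T.adjMatrix ℂ *ᵥ v = (-1 / 2 + μ.im * Complex.I) • v := by
  obtain ⟨u, hu, hAu⟩ := mem_spectrum_iff_exists_mulVec.1 hμ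
  obtain ⟨c, hc⟩ := exists_smul_star_dotProduct_self_eq_one hu
  set v := c • u with hv
  have hAv : T.adjMatrix ℂ *ᵥ v = μ • v := by
    rw [hv, mulVec_smul, hAu, smul_comm]
  have h0 : ∑ i, v i = 0 := by
    have h := hT.sum_adjMatrix_mulVec v
    rw [hAv] at h
    simp only [Pi.smul_apply, smul_eq_mul, ← Finset.mul_sum] at h
    -- e is a left eigenvector for the real number (p-1)/2, so eigenvectors for a nonreal `μ` have
    -- zero sum.
    have hne : μ - (Fintype.card V - 1) / 2 ≠ 0 := by
      intro h'
      apply him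
      have := congrArg Complex.im h'
      simpa [Complex.div_ofNat_im] using this
    refine (mul_eq_zero.1 (?_ : (μ - (Fintype.card V - 1) / 2) * ∑ i, v i = 0)).resolve_left hne
    rw [sub_mul, h, sub_self]
  have hre := hT.isTournament.re_star_dotProduct_adjMatrix_mulVec v
  have hN : ∑ i, Complex.normSq (v i) = 1 := by
    rw [star_dotProduct_self_eq_sum] at hc
    exact_mod_cast hc
  rw [hAv, dotProduct_smul, hc, h0, hN] at hre
  refine ⟨v, h0, hc, ?_⟩
  rw [hAv]
  congr 1
  apply Complex.ext
  · simp at hre ⊢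
    linarith
  · simp

/-- If the adjacency eigenvalues of a regular tournament have imaginary parts in `[-h, h]`, then
the same bound holds for the imaginary part of the quadratic form. -/
theorem IsRegularTournament.abs_im_star_dotProduct_adjMatrix_mulVec_le [DecidableEq V]
    (hT : T.IsRegularTournament) {h : ℝ} (h0 : 0 ≤ h)
    (hh : ∀ μ ∈ spectrum ℂ (T.adjMatrix ℂ), |μ.im| ≤ h) (x : V → ℂ) :
    |(star x ⬝ᵥ T.adjMatrix ℂ *ᵥ x).im| ≤
      h * (∑ i, Complex.normSq (x i) - Complex.normSq (∑ i, x i) / Fintype.card V) := by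
  have hcard : (Fintype.card V : ℂ) ≠ 0 := by
    have := hT.three_le
    exact_mod_cast (by omega : Fintype.card V ≠ 0)
  set A := T.adjMatrix ℂ with hA
  -- H = (A - A*)/(2i) is Hermitian and its form is the imaginary part of that of A.
  set H : Matrix V V ℂ := (Complex.I / 2) • (Aᵀ - A) with hH
  have hAc : Aᴴ = Aᵀ := conjTranspose_adjMatrix T
  have hAt : Aᵀᴴ = A := by rw [← hAc, conjTranspose_conjTranspose]
  have hHerm : H.IsHermitian := by
    rw [IsHermitian, hH, conjTranspose_smul, conjTranspose_sub, hAc, hAt]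
    ext i j
    simp
    ring
  have hHx (x : V → ℂ) : star x ⬝ᵥ H *ᵥ x = ((star x ⬝ᵥ A *ᵥ x).im : ℂ) := by
    rw [hH, smul_mulVec, sub_mulVec, dotProduct_smul, dotProduct_sub, hA,
      star_dotProduct_adjMatrix_transpose_mulVec]
    apply Complex.ext <;> simp
    ring
  have hH1 : H *ᵥ 1 = 0 := by
    rw [hH, smul_mulVec, sub_mulVec]
    ext i
    simp [hA, adjMatrix_mulVec_one, adjMatrix_transpose_mulVec_one, hT.inDegree_eq,
      hT.outDegree_eq]
  have h1H (x : V → ℂ) : star 1 ⬝ᵥ H *ᵥ x = 0 := by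
    rw [dotProduct_mulVec, ← hHerm.eq, ← star_mulVec, hH1, star_zero, zero_dotProduct]
  -- H kills e, so eigenvectors for `μ ≠ 0` lie in e^⊥. There Aᵀ = -I - A, and the equation becomes
  -- A v = (-1/2 + iμ) v.
  have heig (μ : ℝ) (v : V → ℂ) (hv : v ≠ 0) (hμ : H *ᵥ v = (μ : ℂ) • v) : |μ| ≤ h := by
    by_cases hμ0 : μ = 0
    · simpa [hμ0] using h0
    have hs : ∑ i, v i = 0 := by
      have := h1H v
      rw [hμ, dotProduct_smul, star_one, one_dotProduct, smul_eq_mul] at this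
      exact (mul_eq_zero.1 this).resolve_left (by exact_mod_cast hμ0)
    have hmem : (-1 / 2 + μ * Complex.I) ∈ spectrum ℂ A := by
      refine mem_spectrum_iff_exists_mulVec.2 ⟨v, hv, ?_⟩
      ext i
      have := congrFun hμ i
      rw [hH, smul_mulVec, sub_mulVec] at this
      simp only [Pi.smul_apply, Pi.sub_apply, smul_eq_mul, hA,
        hT.isTournament.adjMatrix_transpose_mulVec, hs] at this ⊢
      linear_combination Complex.I * this +
        (1 / 2 * v i + (adjMatrix ℂ T *ᵥ v) i) * Complex.I_sq
    simpa using hh _ hmem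
  set c : ℂ := (∑ i, x i) / Fintype.card V with hc
  -- Projecting off e keeps the form of H and lowers the squared norm by |∑ x|²/p, the correction
  -- term in the bound.
  set y : V → ℂ := x - c • (1 : V → ℂ) with hy
  have hHy : star y ⬝ᵥ H *ᵥ y = star x ⬝ᵥ H *ᵥ x := by
    have : H *ᵥ y = H *ᵥ x := by
      rw [hy, mulVec_sub, mulVec_smul, hH1, smul_zero, sub_zero]
    rw [this, hy, star_sub, star_smul, sub_dotProduct, smul_dotProduct, h1H]
    simp
  have hNy : star y ⬝ᵥ y = ((∑ i, Complex.normSq (x i) -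
      Complex.normSq (∑ i, x i) / Fintype.card V : ℝ) : ℂ) := by
    have h1 : star x ⬝ᵥ (1 : V → ℂ) = star (∑ i, x i) := by
      rw [dotProduct_one, star_sum]
      rfl
    have h2 : (1 : V → ℂ) ⬝ᵥ 1 = Fintype.card V := by simp
    rw [hy, star_sub, star_smul, sub_dotProduct, dotProduct_sub, dotProduct_sub, smul_dotProduct,
      smul_dotProduct, dotProduct_smul, dotProduct_smul, star_one, h1, h2, one_dotProduct,
      star_dotProduct_self_eq_sum]
    push_cast
    rw [Complex.normSq_eq_conj_mul_self, hc]
    simp only [smul_eq_mul, Complex.star_def, map_div₀, map_natCast]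
    field_simp
    ring
  have hone : (((h : ℂ) • (1 : Matrix V V ℂ))).IsHermitian := by
    rw [IsHermitian, conjTranspose_smul, conjTranspose_one]
    simp
  have hp := (hone.add hHerm).re_dotProduct_mulVec_nonneg (fun μ v hv hμ => by
    have : H *ᵥ v = ((μ - h : ℝ) : ℂ) • v := by
      rw [add_mulVec, smul_mulVec, one_mulVec] at hμ
      rw [← add_right_inj ((h : ℂ) • v), hμ, ← add_smul]
      simp
    have := abs_le.1 (heig _ v hv this)
    linarith [this.1]) y
  have hm := (hone.sub hHerm).re_dotProduct_mulVec_nonneg (fun μ v hv hμ => by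
    have : H *ᵥ v = ((h - μ : ℝ) : ℂ) • v := by
      rw [sub_mulVec, smul_mulVec, one_mulVec] at hμ
      rw [Complex.ofReal_sub, sub_smul, ← hμ, sub_sub_cancel]
    have := abs_le.1 (heig _ v hv this)
    linarith [this.2]) y
  rw [add_mulVec, smul_mulVec, one_mulVec, dotProduct_add, dotProduct_smul, hHy, hHx, hNy,
    smul_eq_mul, ← Complex.ofReal_mul, ← Complex.ofReal_add, Complex.ofReal_re] at hp
  rw [sub_mulVec, smul_mulVec, one_mulVec, dotProduct_sub, dotProduct_smul, hHy, hHx, hNy,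
    smul_eq_mul, ← Complex.ofReal_mul, ← Complex.ofReal_sub, Complex.ofReal_re] at hm
  exact abs_le.2 ⟨by linarith, by linarith⟩

end Tournament

end Digraph

/-- A binary quadratic form in complex variables is nonnegative if its discriminant is. -/
theorem quadratic_form_nonneg {α β γ δ : ℝ} (hα : 0 < α) (h : γ ^ 2 + δ ^ 2 ≤ 4 * α * β)
    (u v : ℂ) :
    0 ≤ α * Complex.normSq u + β * Complex.normSq v + γ * (star v * u).re +
      δ * (star v * u).im := by
  simp only [Complex.normSq_apply, Complex.mul_re, Complex.mul_im, Complex.star_def,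
    Complex.conj_re, Complex.conj_im]
  -- After multiplication by 4α the form is |2αu + (γ + iδ)v|² + (4αβ - γ² - δ²)|v|².
  refine (mul_nonneg_iff_of_pos_left (by positivity : 0 < 4 * α)).1 ?_
  have h1 : 0 ≤ (4 * α * β - (γ ^ 2 + δ ^ 2)) * (v.re ^ 2 + v.im ^ 2) :=
    mul_nonneg (by linarith) (by positivity)
  have h2 := sq_nonneg (2 * α * u.re + γ * v.re - δ * v.im)
  have h3 := sq_nonneg (2 * α * u.im + γ * v.im + δ * v.re)
  linarith

/-! ### Numerical ranges spanned by orthonormal eigenvectors, and the quadrilateral -/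

namespace Digraph

section OrthonormalEigenvectors

variable {V ι : Type*} [Fintype V] [Fintype ι] [DecidableEq ι]

/-- Convex combinations of the eigenvalues of orthonormal eigenvectors orthogonal to the all ones
vector belong to the restricted numerical range. -/
theorem sum_smul_mem_restrictedNumericalRange {Γ : Digraph V} {f : ι → V → ℂ} {μ : ι → ℂ}
    (horth : ∀ i j, star (f i) ⬝ᵥ f j = if i = j then 1 else 0) (hsum : ∀ i, ∑ v, f i v = 0)
    (hL : ∀ i, Γ.laplacian ℂ *ᵥ f i = μ i • f i) {w : ι → ℝ} (hw : w ∈ stdSimplex ℝ ι) :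
    ∑ i, w i • μ i ∈ Γ.restrictedNumericalRange := by
  have hsq (i : ι) : (√(w i) : ℂ) * (√(w i) : ℂ) = w i := by
    rw [← Complex.ofReal_mul, Real.mul_self_sqrt (hw.1 i)]
  have hform (g : ι → ℂ) : star (∑ i, (√(w i) : ℂ) • f i) ⬝ᵥ
      (∑ i, ((√(w i) : ℂ) * g i) • f i) = ∑ i, (w i : ℂ) * g i := by
    rw [star_sum, sum_dotProduct]
    refine Finset.sum_congr rfl fun i _ => ?_
    rw [dotProduct_sum, Finset.sum_eq_single i]
    · rw [star_smul, smul_dotProduct, dotProduct_smul, horth, if_pos rfl, ← hsq]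
      simp
      ring
    · intro j _ hj
      rw [star_smul, smul_dotProduct, dotProduct_smul, horth, if_neg hj.symm]
      simp
    · simp
  refine (mem_restrictedNumericalRange_iff _ _).2 ⟨∑ i, (√(w i) : ℂ) • f i, ?_, ?_, ?_⟩
  · simp only [Finset.sum_apply, Pi.smul_apply, smul_eq_mul]
    rw [Finset.sum_comm]
    simp [← Finset.mul_sum, hsum]
  · have := hform 1
    simp only [Pi.one_apply, mul_one] at this
    rw [this]
    exact_mod_cast hw.2
  · have : Γ.laplacian ℂ *ᵥ (∑ i, (√(w i) : ℂ) • f i) = ∑ i, ((√(w i) : ℂ) * μ i) • f i := by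
      rw [mulVec_sum]
      exact Finset.sum_congr rfl fun i _ => by rw [mulVec_smul, hL, smul_smul]
    rw [this, hform]
    simp

/-- The hypotheses make W_r the hull of the values `μ i`, hence convex. As W_r contains every
restricted eigenvalue, it contains their hull, even for eigenvalues outside the chosen family. -/
theorem restrictedNumericalRange_eq_convexHull {Γ : Digraph V} {f : ι → V → ℂ} {μ : ι → ℂ}
    (horth : ∀ i j, star (f i) ⬝ᵥ f j = if i = j then 1 else 0) (hsum : ∀ i, ∑ v, f i v = 0)
    (hL : ∀ i, Γ.laplacian ℂ *ᵥ f i = μ i • f i)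
    (h : ∀ z ∈ Γ.restrictedNumericalRange, ∃ w ∈ stdSimplex ℝ ι, ∑ i, w i • μ i = z) :
    Γ.restrictedNumericalRange = convexHull ℝ Γ.restrictedEigenvalues := by
  have hμ (i : ι) : μ i ∈ Γ.restrictedEigenvalues := by
    refine ⟨f i, fun h0 => ?_, hsum i, 0, fun v => by simp [hL]⟩
    have := horth i i
    simp [h0] at this
  refine Set.Subset.antisymm (fun z hz => ?_) ?_
  · obtain ⟨w, hw, rfl⟩ := h z hz
    exact (convex_convexHull ℝ _).sum_mem (fun i _ => hw.1 i) hw.2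
      (fun i _ => subset_convexHull ℝ _ (hμ i))
  · have heq : Γ.restrictedNumericalRange =
        Fintype.linearCombination ℝ μ '' stdSimplex ℝ ι := by
      refine Set.Subset.antisymm (fun z hz => h z hz) ?_
      rintro _ ⟨w, hw, rfl⟩
      exact sum_smul_mem_restrictedNumericalRange horth hsum hL hw
    refine convexHull_min (restrictedEigenvalues_subset_restrictedNumericalRange Γ) ?_
    rw [heq]
    exact (convex_stdSimplex ℝ ι).linear_image _

end OrthonormalEigenvectors

/-- A point of the quadrilateral with vertices `0`, `n`, `m ± h i`, in barycentric coordinates. -/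
theorem exists_mem_stdSimplex_of_abs_im_le {n m h : ℝ} (hn : 0 < n) (hh : 0 < h) {z : ℂ}
    (h1 : m * |z.im| ≤ h * z.re) (h2 : (n - m) * |z.im| ≤ h * (n - z.re)) :
    ∃ w ∈ stdSimplex ℝ (Fin 4),
      ∑ i, w i • (![0, (n : ℂ), m - h * Complex.I, m + h * Complex.I] : Fin 4 → ℂ) i = z := by
  have ha := neg_abs_le z.im
  have hb := le_abs_self z.im
  set s := |z.im| with hs
  -- `w₃` and `w₄` account for the imaginary part, and one of them vanishes. `w₂` is then forced by
  -- the real part and `w₁` by total weight 1; the hypotheses are exactly their nonnegativity.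
  set w₂ := (h * z.re - m * s) / (h * n) with hw₂
  set w₁ := (h * (n - z.re) - (n - m) * s) / (h * n) with hw₁
  have hw₂0 : 0 ≤ w₂ := div_nonneg (by linarith) (by positivity)
  have hw₁0 : 0 ≤ w₁ := div_nonneg (by linarith) (by positivity)
  set w₃ := (s - z.im) / (2 * h) with hw₃
  set w₄ := (s + z.im) / (2 * h) with hw₄
  have hw₃0 : 0 ≤ w₃ := div_nonneg (by linarith) (by positivity)
  have hw₄0 : 0 ≤ w₄ := div_nonneg (by linarith) (by positivity)
  refine ⟨![w₁, w₂, w₃, w₄], ⟨?_, ?_⟩, ?_⟩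
  · intro i
    fin_cases i
    exacts [hw₁0, hw₂0, hw₃0, hw₄0]
  · simp only [Fin.sum_univ_four, cons_val]
    rw [hw₁, hw₂, hw₃, hw₄]
    field_simp
    ring
  · simp only [Fin.sum_univ_four, cons_val]
    clear_value w₁
    apply Complex.ext
    · have : w₂ * n + w₃ * m + w₄ * m = z.re := by
        rw [hw₂, hw₃, hw₄]
        field_simp
        ring
      simpa using this
    · have : -(w₃ * h) + w₄ * h = z.im := by
        rw [hw₃, hw₄]
        field_simp
        ring
      simpa using this

section PickJoin

variable {V : Type*} [Fintype V] {T : Digraph V} {t : ℕ}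

/-- The digraph `(K₂ →∨ T) →∨ K̄ₜ`. -/
abbrev tripleJoin (T : Digraph V) (t : ℕ) : Digraph ((Fin 2 ⊕ V) ⊕ Fin t) :=
  ((complete (Fin 2)).directedJoin T).directedJoin (Digraph.emptyDigraph (Fin t))

theorem IsTournament.isSimple_tripleJoin {V : Type*} {T : Digraph V} {t : ℕ}
    (hT : T.IsTournament) : (tripleJoin T t).IsSimple := by
  rintro ((i | i) | i)
  · simp [directedJoin, complete]
  · simpa [directedJoin] using hT.1 i
  · simp [directedJoin]

theorem IsRegularTournament.laplacian_tripleJoin_mulVec (hT : T.IsRegularTournament)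
    (x : Fin 2 → ℂ) (y : V → ℂ) (z : Fin t → ℂ) :
    (tripleJoin T t).laplacian ℂ *ᵥ Sum.elim (Sum.elim x y) z = Sum.elim (Sum.elim
      (fun i => (2 + Fintype.card V + t) * x i - (∑ i, x i + ∑ i, y i + ∑ i, z i))
      (fun i => ((Fintype.card V - 1) / 2 + t) * y i - (T.adjMatrix ℂ *ᵥ y) i - ∑ i, z i)) 0 := by
  rw [laplacian_directedJoin_mulVec, laplacian_directedJoin_mulVec,
    laplacian_emptyDigraph_mulVec]
  congr 1
  ext (i | i)
  · simp only [Sum.elim_inl, laplacian_complete_mulVec_apply, Fintype.card_fin]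
    push_cast
    ring
  · simp only [Sum.elim_inr, hT.laplacian_mulVec_apply, Fintype.card_fin]
    ring

theorem star_elim_dotProduct_elim {α β : Type*} [Fintype α] [Fintype β] (x x' : α → ℂ)
    (y y' : β → ℂ) : star (Sum.elim x y) ⬝ᵥ Sum.elim x' y' = star x ⬝ᵥ x' + star y ⬝ᵥ y' := by
  simp [dotProduct]

theorem normSq_sum_le {α : Type*} [Fintype α] (x : α → ℂ) :
    Complex.normSq (∑ i, x i) ≤ Fintype.card α * ∑ i, Complex.normSq (x i) := by
  simp only [Complex.normSq_eq_norm_sq]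
  calc ‖∑ i, x i‖ ^ 2 ≤ (∑ i, ‖x i‖) ^ 2 := by
        gcongr
        exact norm_sum_le _ _
    _ ≤ _ := sq_sum_le_card_mul_sum_sq

/-- The quadratic form of the triple join on unit vectors orthogonal to the all ones vector. -/
theorem IsRegularTournament.exists_of_mem_restrictedNumericalRange_tripleJoin [DecidableEq V]
    (hT : T.IsRegularTournament) {h : ℝ} (h0 : 0 ≤ h)
    (hh : ∀ μ ∈ spectrum ℂ (T.adjMatrix ℂ), |μ.im| ≤ h) {ζ : ℂ}
    (hζ : ζ ∈ (tripleJoin T t).restrictedNumericalRange) :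
    ∃ (u v : ℂ) (a b c f : ℝ), Complex.normSq u ≤ 2 * a ∧ Complex.normSq (u + v) ≤ t * c ∧
      |f| ≤ h * (b - Complex.normSq v / Fintype.card V) ∧ a + b + c = 1 ∧
      ζ.re = (2 + Fintype.card V + t) * a + (Fintype.card V / 2 + t) * b +
        Complex.normSq v / 2 + (star v * u).re ∧
      ζ.im = (star v * u).im - f := by
  obtain ⟨X, hX0, hX1, rfl⟩ := (mem_restrictedNumericalRange_iff _ _).1 hζ
  obtain ⟨x, y, z, rfl⟩ : ∃ x y z, X = Sum.elim (Sum.elim x y) z :=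
    ⟨X ∘ Sum.inl ∘ Sum.inl, X ∘ Sum.inl ∘ Sum.inr, X ∘ Sum.inr, by ext ((i | i) | i) <;> rfl⟩
  simp only [Fintype.sum_sum_type, Sum.elim_inl, Sum.elim_inr] at hX0
  rw [star_elim_dotProduct_elim, star_elim_dotProduct_elim, star_dotProduct_self_eq_sum,
    star_dotProduct_self_eq_sum, star_dotProduct_self_eq_sum] at hX1
  -- u, v are the block sums on K₂ and T, and a, b, c the squared block norms. The sum over K̄_t is
  -- -(u + v), so Cauchy–Schwarz bounds |u|² and |u + v|².
  refine ⟨∑ i, x i, ∑ i, y i, ∑ i, Complex.normSq (x i), ∑ i, Complex.normSq (y i),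
    ∑ i, Complex.normSq (z i), (star y ⬝ᵥ T.adjMatrix ℂ *ᵥ y).im, ?_, ?_,
    hT.abs_im_star_dotProduct_adjMatrix_mulVec_le h0 hh y, by exact_mod_cast hX1, ?_⟩
  · simpa using normSq_sum_le x
  · rw [eq_neg_of_add_eq_zero_left hX0, Complex.normSq_neg]
    simpa using normSq_sum_le z
  have hre := hT.isTournament.re_star_dotProduct_adjMatrix_mulVec y
  have hL : (tripleJoin T t).laplacian ℂ *ᵥ Sum.elim (Sum.elim x y) z = Sum.elim (Sum.elim
      ((2 + Fintype.card V + t : ℂ) • x)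
      (((Fintype.card V - 1) / 2 + t : ℂ) • y - T.adjMatrix ℂ *ᵥ y +
        (∑ i, x i + ∑ i, y i) • (1 : V → ℂ))) 0 := by
    rw [hT.laplacian_tripleJoin_mulVec, hX0, eq_neg_of_add_eq_zero_left hX0]
    congr 2
    · ext i
      simp
    · ext i
      simp [sub_eq_add_neg]
  have hform : star (Sum.elim (Sum.elim x y) z) ⬝ᵥ
      (tripleJoin T t).laplacian ℂ *ᵥ Sum.elim (Sum.elim x y) z =
      ((2 + Fintype.card V + t) * ∑ i, Complex.normSq (x i) +
        ((Fintype.card V - 1) / 2 + t) * ∑ i, Complex.normSq (y i) +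
        Complex.normSq (∑ i, y i) : ℝ) - star y ⬝ᵥ T.adjMatrix ℂ *ᵥ y +
        star (∑ i, y i) * ∑ i, x i := by
    rw [hL, star_elim_dotProduct_elim, star_elim_dotProduct_elim, dotProduct_zero,
      dotProduct_add, dotProduct_sub, dotProduct_smul, dotProduct_smul, dotProduct_smul,
      star_dotProduct_self_eq_sum, star_dotProduct_self_eq_sum, dotProduct_one]
    have : ∑ i, star y i = star (∑ i, y i) := by
      rw [star_sum]
      rfl
    rw [this]
    push_cast
    rw [Complex.normSq_eq_conj_mul_self (z := ∑ i, y i), Complex.star_def]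
    simp only [smul_eq_mul]
    ring
  rw [hform]
  constructor
  · rw [Complex.add_re, Complex.sub_re, Complex.ofReal_re, hre]
    ring
  · rw [Complex.add_im, Complex.sub_im, Complex.ofReal_im]
    ring

/-- The elementary inequalities placing the quadratic form inside the quadrilateral. -/
theorem abs_im_le_of_quadratic_form {p t h : ℝ} (hp : 3 ≤ p) (ht : 0 < t) (htp : t ≤ p)
    (hh0 : 0 < h) (hh : p ^ 2 / 12 ≤ h ^ 2) {u v : ℂ} {a b c f re im : ℝ}
    (ha : Complex.normSq u ≤ 2 * a) (hc : Complex.normSq (u + v) ≤ t * c)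
    (hf : |f| ≤ h * (b - Complex.normSq v / p)) (habc : a + b + c = 1)
    (hre : re = (2 + p + t) * a + (p / 2 + t) * b + Complex.normSq v / 2 + (star v * u).re)
    (him : im = (star v * u).im - f) :
    (p / 2 + t) * |im| ≤ h * re ∧ (2 + p + t - (p / 2 + t)) * |im| ≤ h * (2 + p + t - re) := by
  have hp0 : 0 < p := by linarith
  have hmf := mul_le_mul_of_nonneg_left hf (by positivity : 0 ≤ p / 2 + t)
  have hnf := mul_le_mul_of_nonneg_left hf (by positivity : 0 ≤ p / 2 + 2)
  have hf1 := neg_abs_le f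
  have hf2 := le_abs_self f
  constructor
  -- Inserting a ≥ |u|²/2 and the bound on |f| cancels b and leaves a form in u, v with α =
  -- h(2+p+t)/2, β = h(p+t)/p, γ = h, δ = ±(p/2+t). With h² ≥ p²/12 its discriminant condition
  -- becomes polynomial and follows from p ≥ 3 and t ≤ p.
  · have hdisc : h ^ 2 + (p / 2 + t) ^ 2 ≤
        4 * (h * (2 + p + t) / 2) * (h * (p + t) / p) := by
      have hk : (p / 2 + t) ^ 2 ≤ p ^ 2 / 12 * (2 * (2 + p + t) * (p + t) / p - 1) := by
        have : p ^ 2 / 12 * (2 * (2 + p + t) * (p + t) / p - 1) =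
            p * (2 * (2 + p + t) * (p + t) - p) / 12 := by
          field_simp
        rw [this]
        nlinarith [mul_nonneg (sub_nonneg.2 hp) (sq_nonneg (p + t)),
          mul_nonneg (sub_nonneg.2 htp) (add_pos hp0 ht).le]
      have hk0 : 0 ≤ 2 * (2 + p + t) * (p + t) / p - 1 := by
        rw [sub_nonneg, le_div_iff₀ hp0]
        nlinarith [mul_pos hp0 ht]
      have := hk.trans (mul_le_mul_of_nonneg_right hh hk0)
      calc h ^ 2 + (p / 2 + t) ^ 2 ≤
          h ^ 2 + h ^ 2 * (2 * (2 + p + t) * (p + t) / p - 1) := by linarith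
        _ = _ := by ring
    have hα : 0 < h * (2 + p + t) / 2 := by positivity
    -- The two signs of δ serve the two cases of the absolute value.
    have q1 := quadratic_form_nonneg hα hdisc u v
    have q2 := quadratic_form_nonneg (δ := -(p / 2 + t)) hα ((neg_sq (p / 2 + t)).symm ▸ hdisc) u v
    have ha' := mul_le_mul_of_nonneg_left ha hα.le
    have hv : h * (p + t) / p * Complex.normSq v =
        h * (p / 2 + t) * (Complex.normSq v / p) + h * (Complex.normSq v / 2) := by
      field_simp
      ring
    rw [hv] at q1 q2
    have hm0 : 0 ≤ p / 2 + t := by positivity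
    have hf1' := mul_le_mul_of_nonneg_left hf1 hm0
    have hf2' := mul_le_mul_of_nonneg_left hf2 hm0
    rw [hre, him]
    rcases abs_cases ((star v * u).im - f) with ⟨h', -⟩ | ⟨h', -⟩ <;> rw [h'] <;> linarith
  · have hN : 0 < (2 + p + t) / t := by positivity
    -- Equivalent to (p - t)(p + 2) ≥ 0, hence to t ≤ p.
    have hNp : 2 * p + 2 ≤ (2 + p + t) / t * p := by
      rw [div_mul_eq_mul_div, le_div_iff₀ ht]
      nlinarith
    have hhc : h * ((2 + p + t) / t) * Complex.normSq (u + v) ≤ h * (2 + p + t) * c := by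
      refine (mul_le_mul_of_nonneg_left hc (by positivity)).trans_eq ?_
      field_simp
    set N := (2 + p + t) / t
    -- Here a is eliminated by a + b + c = 1 and c is bounded below by |u + v|²/t, which gives the
    -- coefficients hN, h(N + 2/p), h(2N - 1) and ±(p/2 + 2).
    have hdisc : (h * (2 * N - 1)) ^ 2 + (p / 2 + 2) ^ 2 ≤ 4 * (h * N) * (h * (N + 2 / p)) := by
      have hk : (p / 2 + 2) ^ 2 ≤ p ^ 2 / 12 * (8 * N / p + 4 * N - 1) := by
        have : p ^ 2 / 12 * (8 * N / p + 4 * N - 1) = (N * p * (8 + 4 * p) - p ^ 2) / 12 := by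
          field_simp
        rw [this]
        nlinarith [mul_le_mul_of_nonneg_right hNp (by positivity : 0 ≤ 8 + 4 * p)]
      have hk0 : 0 ≤ 8 * N / p + 4 * N - 1 := by
        have : 0 ≤ 8 * N / p := by positivity
        nlinarith
      have := hk.trans (mul_le_mul_of_nonneg_right hh hk0)
      calc (h * (2 * N - 1)) ^ 2 + (p / 2 + 2) ^ 2 ≤
          (h * (2 * N - 1)) ^ 2 + h ^ 2 * (8 * N / p + 4 * N - 1) := by linarith
        _ = _ := by ring
    have hα : 0 < h * N := by positivity
    have q1 := quadratic_form_nonneg hα hdisc u v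
    have q2 := quadratic_form_nonneg (δ := -(p / 2 + 2)) hα ((neg_sq (p / 2 + 2)).symm ▸ hdisc) u v
    have huv : Complex.normSq (u + v) =
        Complex.normSq u + Complex.normSq v + 2 * (star v * u).re := by
      rw [Complex.normSq_add, mul_comm u]
      rfl
    rw [huv] at hhc
    have hv : h * (N + 2 / p) * Complex.normSq v = h * N * Complex.normSq v +
        h * (p / 2 + 2) * (Complex.normSq v / p) - h * (Complex.normSq v / 2) := by
      field_simp
      ring
    rw [hv] at q1 q2
    have hm0 : 0 ≤ p / 2 + 2 := by positivity
    have hf1' := mul_le_mul_of_nonneg_left hf1 hm0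
    have hf2' := mul_le_mul_of_nonneg_left hf2 hm0
    have hb : h * (2 + p + t - re) = h * (2 + p + t) * c + h * (p / 2 + 2) * b -
        h * (Complex.normSq v / 2) - h * (star v * u).re := by
      rw [hre, show a = 1 - b - c by linarith]
      ring
    rw [hb, him]
    rcases abs_cases ((star v * u).im - f) with ⟨h', -⟩ | ⟨h', -⟩ <;> rw [h'] <;> linarith

end PickJoin

end Digraph

/-! ### Pseudo-normality and spread of the triple join -/

namespace Digraph

theorem mem_restrictedRayleighSet_of_laplacian_mulVec_eq {V : Type*} [Fintype V] {Γ : Digraph V}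
    {x : V → ℝ} {μ : ℝ} (h0 : ∑ i, x i = 0) (h1 : x ⬝ᵥ x = 1)
    (hL : (Γ.laplacian ℂ *ᵥ fun i => (x i : ℂ)) = (μ : ℂ) • fun i => (x i : ℂ)) :
    μ ∈ Γ.restrictedRayleighSet := by
  refine (mem_restrictedRayleighSet_iff _ _).2 ⟨x, h0, h1, ?_⟩
  have : Γ.laplacian ℝ *ᵥ x = μ • x := by
    ext i
    have := congrFun hL i
    rw [← ofReal_laplacian_mulVec] at this
    simpa using Complex.ofReal_injective (this.trans (Complex.ofReal_mul _ _).symm)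
  rw [this, dotProduct_smul, h1, smul_eq_mul, mul_one]

theorem exists_sum_eq_zero_dotProduct_self_eq_one (V : Type*) [Fintype V] [Nontrivial V] :
    ∃ x : V → ℝ, ∑ i, x i = 0 ∧ x ⬝ᵥ x = 1 := by
  obtain ⟨r, hr⟩ := restrictedRayleighSet_nonempty (Digraph.emptyDigraph V)
  obtain ⟨x, h0, h1, -⟩ := (mem_restrictedRayleighSet_iff _ _).1 hr
  exact ⟨x, h0, h1⟩

section PickJoin

variable {V : Type*} [Fintype V] {T : Digraph V} {t : ℕ}

/-- A normal L would satisfy Lᴴ e = 0, but each column of L indexed by K̄_t sums to -(2+p). -/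
theorem IsRegularTournament.tripleJoin_not_isStarNormal (hT : T.IsRegularTournament) (ht : 0 < t)
    [DecidableEq V] : ¬ IsStarNormal ((tripleJoin T t).laplacian ℂ) := by
  intro hN
  have h := conjTranspose_mulVec_eq_of_isStarNormal hN (v := 1) (μ := 0)
    (by rw [laplacian_mulVec_one, zero_smul])
  have h2 : star (Sum.elim (Sum.elim 0 0) 1 : (Fin 2 ⊕ V) ⊕ Fin t → ℂ) ⬝ᵥ
      ((tripleJoin T t).laplacian ℂ)ᴴ *ᵥ 1 = 0 := by
    rw [h]
    simp
  rw [dotProduct_mulVec, ← star_mulVec, hT.laplacian_tripleJoin_mulVec,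
    star_dotProduct_one_eq_zero_iff, Fintype.sum_sum_type, Fintype.sum_sum_type] at h2
  simp at h2
  have h3 : ((2 + Fintype.card V) * t : ℂ) = 0 := by linear_combination -h2
  norm_cast at h3
  have : 0 < (2 + Fintype.card V) * t := by positivity
  omega

/-- The zero-sum vector x equal to t on K₂ ∪ T and to -(2+p) on K̄_t is a restricted eigenvector for
t. Pairing Lᴴ x and t x with the indicator of K₂ gives 2t(p+t) and 2t², which differ by 2pt. -/
theorem IsRegularTournament.restrictedLaplacian_tripleJoin_not_isStarNormal
    (hT : T.IsRegularTournament) (ht : 0 < t)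
    {Q : Matrix ((Fin 2 ⊕ V) ⊕ Fin t) (Fin (Fintype.card ((Fin 2 ⊕ V) ⊕ Fin t) - 1)) ℂ}
    (hQ : IsRestrictor Q) : ¬ IsStarNormal ((tripleJoin T t).restrictedLaplacian Q) := by
  have hA (c : ℂ) (i : V) : (T.adjMatrix ℂ *ᵥ fun _ => c) i = (Fintype.card V - 1) / 2 * c := by
    have : (fun _ => c) = c • (1 : V → ℂ) := by
      ext
      simp
    rw [this, mulVec_smul, Pi.smul_apply, adjMatrix_mulVec_one, hT.outDegree_eq,
      hT.cast_half_card_sub_one, smul_eq_mul, mul_comm]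
  set x : (Fin 2 ⊕ V) ⊕ Fin t → ℂ := Sum.elim (Sum.elim (fun _ => (t : ℂ)) (fun _ => (t : ℂ)))
    (fun _ => -(2 + Fintype.card V : ℂ)) with hx
  have hx0 : ∑ i, x i = 0 := by
    rw [hx, Fintype.sum_sum_type, Fintype.sum_sum_type]
    simp
    ring
  have hL (i) : ((tripleJoin T t).laplacian ℂ *ᵥ x) i =
      (t : ℂ) * x i + t * (2 + Fintype.card V) := by
    rw [hx, hT.laplacian_tripleJoin_mulVec]
    obtain ((i | i) | i) := i
    · simp
      ring
    · simp [hA]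
      ring
    · simp
      ring
  refine hQ.not_isStarNormal_restrictedLaplacian hx0 hL fun h => ?_
  have h2 := congrArg
    (fun y => star (Sum.elim (Sum.elim 1 0) 0 : (Fin 2 ⊕ V) ⊕ Fin t → ℂ) ⬝ᵥ y) h
  rw [dotProduct_mulVec, ← star_mulVec, hT.laplacian_tripleJoin_mulVec, hx, dotProduct_smul,
    star_elim_dotProduct_elim, star_elim_dotProduct_elim, star_elim_dotProduct_elim,
    star_elim_dotProduct_elim] at h2
  simp [dotProduct] at h2
  have h3 : (2 * Fintype.card V * t : ℂ) = 0 := by linear_combination h2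
  norm_cast at h3
  have := hT.three_le
  have : 0 < 2 * Fintype.card V * t := by positivity
  omega

theorem IsRegularTournament.laplacian_tripleJoin_mulVec_bottom (hT : T.IsRegularTournament)
    {z : Fin t → ℂ} (hz : ∑ i, z i = 0) :
    (tripleJoin T t).laplacian ℂ *ᵥ Sum.elim (Sum.elim 0 0) z = 0 := by
  rw [hT.laplacian_tripleJoin_mulVec, hz]
  ext ((i | i) | i) <;> simp

theorem IsRegularTournament.laplacian_tripleJoin_mulVec_top (hT : T.IsRegularTournament)
    {x : Fin 2 → ℂ} (hx : ∑ i, x i = 0) :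
    (tripleJoin T t).laplacian ℂ *ᵥ Sum.elim (Sum.elim x 0) 0 =
      ((2 + Fintype.card V + t : ℝ) : ℂ) • Sum.elim (Sum.elim x 0) 0 := by
  rw [hT.laplacian_tripleJoin_mulVec, hx]
  ext ((i | i) | i) <;> simp

theorem IsRegularTournament.laplacian_tripleJoin_mulVec_middle (hT : T.IsRegularTournament)
    {y : V → ℂ} (hy : ∑ i, y i = 0) {μ : ℂ} (hA : T.adjMatrix ℂ *ᵥ y = (-1 / 2 + μ) • y) :
    (tripleJoin T t).laplacian ℂ *ᵥ Sum.elim (Sum.elim 0 y) 0 =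
      ((Fintype.card V / 2 + t : ℝ) - μ) •
        (Sum.elim (Sum.elim 0 y) 0 : (Fin 2 ⊕ V) ⊕ Fin t → ℂ) := by
  rw [hT.laplacian_tripleJoin_mulVec, hy, hA]
  ext ((i | i) | i)
  · simp
  · simp
    ring
  · simp

/-- On e^⊥ an eigenvector y of A is also one of Aᵀ = A*, here with eigenvalue -1/2 - ih. Evaluating
y'*Aᵀy through y and through y' gives 2ih · y'*y = 0. -/
theorem IsTournament.star_dotProduct_eq_zero_of_eigenvectors (hT : T.IsTournament) {h : ℝ}
    (hh : h ≠ 0) {y y' : V → ℂ} (hy : ∑ i, y i = 0)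
    (hA : T.adjMatrix ℂ *ᵥ y = (-1 / 2 + h * Complex.I) • y)
    (hA' : T.adjMatrix ℂ *ᵥ y' = (-1 / 2 - h * Complex.I) • y') : star y ⬝ᵥ y' = 0 := by
  have ht : (T.adjMatrix ℂ)ᵀ *ᵥ y = (-1 / 2 - h * Complex.I) • y := by
    ext i
    rw [hT.adjMatrix_transpose_mulVec, hy, hA]
    simp
    ring
  have h1 := star_dotProduct_adjMatrix_transpose_mulVec T y' y
  rw [ht, hA', dotProduct_smul, dotProduct_smul, star_smul, star_dotProduct y y'] at h1
  have h2 : (2 * h * Complex.I) * (star y' ⬝ᵥ y) = 0 := by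
    simp only [smul_eq_mul, starRingEnd_self_apply, Complex.star_def, map_sub, map_mul, map_div₀, map_neg,
      map_one, Complex.conj_I, Complex.conj_ofReal, map_ofNat] at h1
    linear_combination -h1
  rw [star_dotProduct, (mul_eq_zero.1 h2).resolve_left (by simp [hh]), star_zero]

theorem IsRegularPickTournament.mem_restrictedNumericalRange_tripleJoin
    (hT : T.IsRegularPickTournament) (ht : 0 < t) (htp : t ≤ Fintype.card V) {ζ : ℂ}
    (hζ : ζ ∈ (tripleJoin T t).restrictedNumericalRange) :
    (Fintype.card V / 2 + t) * |ζ.im| ≤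
        1 / 2 * Real.cot (Real.pi / (2 * Fintype.card V)) * ζ.re ∧
      (2 + Fintype.card V + t - (Fintype.card V / 2 + t)) * |ζ.im| ≤
        1 / 2 * Real.cot (Real.pi / (2 * Fintype.card V)) * (2 + Fintype.card V + t - ζ.re) := by
  classical
  have hp : (3 : ℝ) ≤ Fintype.card V := by exact_mod_cast hT.isRegularTournament.three_le
  have hh := Real.half_cot_pos hp
  obtain ⟨u, v, a, b, c, f, ha, hc, hf, habc, hre, him⟩ :=
    hT.isRegularTournament.exists_of_mem_restrictedNumericalRange_tripleJoin hh.le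
      (fun μ hμ => abs_le.2 ⟨hT.isLeast_im.2 ⟨μ, hμ, rfl⟩, hT.isGreatest_im.2 ⟨μ, hμ, rfl⟩⟩) hζ
  exact abs_im_le_of_quadratic_form hp (by exact_mod_cast ht) (by exact_mod_cast htp) hh
    (Real.sq_div_twelve_le_sq_half_cot hp) ha hc hf habc hre him

theorem IsRegularPickTournament.restrictedNumericalRange_tripleJoin
    (hT : T.IsRegularPickTournament) (ht : 2 ≤ t) (htp : t ≤ Fintype.card V) :
    (tripleJoin T t).restrictedNumericalRange =
      convexHull ℝ (tripleJoin T t).restrictedEigenvalues := by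
  classical
  have hR := hT.isRegularTournament
  have hp : (3 : ℝ) ≤ Fintype.card V := by exact_mod_cast hR.three_le
  have hh := Real.half_cot_pos hp
  obtain ⟨μ₁, hμ₁, him₁⟩ := hT.isGreatest_im.1
  obtain ⟨μ₂, hμ₂, him₂⟩ := hT.isLeast_im.1
  have hmem := fun ζ => hT.mem_restrictedNumericalRange_tripleJoin (ζ := ζ)
    (by omega : 0 < t) htp
  set h := 1 / 2 * Real.cot (Real.pi / (2 * Fintype.card V))
  obtain ⟨y₁, hy₁0, hy₁1, hAy₁⟩ := hR.exists_eigenvector hμ₁ (by rw [him₁]; exact hh.ne')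
  obtain ⟨y₂, hy₂0, hy₂1, hAy₂⟩ := hR.exists_eigenvector hμ₂
    (by rw [him₂]; exact (neg_lt_zero.2 hh).ne)
  rw [him₁] at hAy₁
  rw [him₂, Complex.ofReal_neg, neg_mul] at hAy₂
  have hy₁₂ : star y₁ ⬝ᵥ y₂ = 0 :=
    hR.isTournament.star_dotProduct_eq_zero_of_eigenvectors hh.ne' hy₁0 hAy₁ hAy₂
  have hy₂₁ : star y₂ ⬝ᵥ y₁ = 0 := by
    rw [star_dotProduct, hy₁₂, star_zero]
  have : Nontrivial (Fin t) := Fin.nontrivial_iff_two_le.2 ht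
  have hunit {α : Type} [Fintype α] [Nontrivial α] :
      ∃ x : α → ℂ, ∑ i, x i = 0 ∧ star x ⬝ᵥ x = 1 := by
    obtain ⟨x, h0, h1⟩ := exists_sum_eq_zero_dotProduct_self_eq_one α
    refine ⟨fun i => (x i : ℂ), by simpa using congrArg Complex.ofReal h0, ?_⟩
    simpa [dotProduct] using congrArg Complex.ofReal h1
  obtain ⟨x, hx0, hx1⟩ := hunit (α := Fin 2)
  obtain ⟨z, hz0, hz1⟩ := hunit (α := Fin t)
  -- t ≥ 2 is what provides a zero-sum unit vector on K̄_t. The signs of ±hi are swapped relative to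
  -- A because L contains -A.
  refine restrictedNumericalRange_eq_convexHull
    (f := ![Sum.elim (Sum.elim 0 0) z, Sum.elim (Sum.elim x 0) 0, Sum.elim (Sum.elim 0 y₁) 0,
      Sum.elim (Sum.elim 0 y₂) 0])
    (μ := ![0, ((2 + Fintype.card V + t : ℝ) : ℂ), (Fintype.card V / 2 + t : ℝ) - h * Complex.I,
      (Fintype.card V / 2 + t : ℝ) + h * Complex.I]) ?_ ?_ ?_ ?_
  · intro i j
    fin_cases i <;> fin_cases j <;>
      simp [star_elim_dotProduct_elim, hx1, hz1, hy₁1, hy₂1, hy₁₂, hy₂₁]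
  · intro i
    fin_cases i <;> simp [Fintype.sum_sum_type, hx0, hz0, hy₁0, hy₂0]
  · intro i
    fin_cases i
    · exact (hR.laplacian_tripleJoin_mulVec_bottom hz0).trans (zero_smul _ _).symm
    · exact hR.laplacian_tripleJoin_mulVec_top hx0
    · exact hR.laplacian_tripleJoin_mulVec_middle hy₁0 hAy₁
    · refine (hR.laplacian_tripleJoin_mulVec_middle hy₂0 hAy₂).trans ?_
      rw [sub_neg_eq_add]
      rfl
  · intro ζ hζ
    exact exists_mem_stdSimplex_of_abs_im_le (by positivity) hh (hmem ζ hζ).1 (hmem ζ hζ).2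

theorem IsRegularPickTournament.isPseudoNormal_tripleJoin (hT : T.IsRegularPickTournament)
    (ht : 2 ≤ t) (htp : t ≤ Fintype.card V) : (tripleJoin T t).IsPseudoNormal where
  isPolygonal := by
    refine ⟨hT.isRegularTournament.isTournament.isSimple_tripleJoin, fun Q hQ => ?_⟩
    rw [hQ.spectrum_restrictedLaplacian, hT.restrictedNumericalRange_tripleJoin ht htp]
  not_normal := by
    classical
    exact hT.isRegularTournament.tripleJoin_not_isStarNormal (by omega)
  not_restricted_normal _ hQ :=
    hT.isRegularTournament.restrictedLaplacian_tripleJoin_not_isStarNormal (by omega) hQ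

/-- For a real point the side inequalities reduce to 0 ≤ r ≤ n; zero-sum unit vectors on K̄_t and on
K₂ attain the two ends. -/
theorem IsRegularPickTournament.laplacianSpread_tripleJoin (hT : T.IsRegularPickTournament)
    (ht : 2 ≤ t) (htp : t ≤ Fintype.card V) :
    (tripleJoin T t).laplacianSpread = 2 + Fintype.card V + t := by
  have hR := hT.isRegularTournament
  have hp : (3 : ℝ) ≤ Fintype.card V := by exact_mod_cast hR.three_le
  have hh := Real.half_cot_pos hp
  have hbound (r : ℝ) (hr : r ∈ (tripleJoin T t).restrictedRayleighSet) :
      0 ≤ r ∧ r ≤ 2 + Fintype.card V + t := by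
    have h := hT.mem_restrictedNumericalRange_tripleJoin (by omega) htp
      (ofReal_mem_restrictedNumericalRange hr)
    rw [Complex.ofReal_im, abs_zero, mul_zero, mul_zero, Complex.ofReal_re] at h
    exact ⟨(mul_nonneg_iff_of_pos_left hh).1 h.1,
      sub_nonneg.1 ((mul_nonneg_iff_of_pos_left hh).1 h.2)⟩
  have : Nontrivial (Fin t) := Fin.nontrivial_iff_two_le.2 ht
  obtain ⟨x, hx0, hx1⟩ := exists_sum_eq_zero_dotProduct_self_eq_one (Fin 2)
  obtain ⟨z, hz0, hz1⟩ := exists_sum_eq_zero_dotProduct_self_eq_one (Fin t)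
  have hmin : (0 : ℝ) ∈ (tripleJoin T t).restrictedRayleighSet := by
    refine mem_restrictedRayleighSet_of_laplacian_mulVec_eq
      (x := Sum.elim (Sum.elim 0 0) z) ?_ ?_ ?_
    · simp [Fintype.sum_sum_type, hz0]
    · simpa [dotProduct] using hz1
    · have hz : ∑ i, (z i : ℂ) = 0 := by simpa using congrArg Complex.ofReal hz0
      have := hR.laplacian_tripleJoin_mulVec_bottom hz
      have he : (fun i => ((Sum.elim (Sum.elim 0 0) z : (Fin 2 ⊕ V) ⊕ Fin t → ℝ) i : ℂ)) =
          Sum.elim (Sum.elim (0 : Fin 2 → ℂ) (0 : V → ℂ)) (fun i => (z i : ℂ)) := by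
        ext ((i | i) | i) <;> simp
      rw [he, this]
      simp
  have hmax : (2 + Fintype.card V + t : ℝ) ∈ (tripleJoin T t).restrictedRayleighSet := by
    refine mem_restrictedRayleighSet_of_laplacian_mulVec_eq
      (x := Sum.elim (Sum.elim x 0) 0) ?_ ?_ ?_
    · simp only [Fintype.sum_sum_type, Sum.elim_inl, Sum.elim_inr, hx0]
      simp
    · simpa [dotProduct] using hx1
    · have hx : ∑ i, (x i : ℂ) = 0 := by
        rw [← Complex.ofReal_sum, hx0, Complex.ofReal_zero]
      have := hR.laplacian_tripleJoin_mulVec_top (t := t) hx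
      have he : (fun i => ((Sum.elim (Sum.elim x 0) 0 : (Fin 2 ⊕ V) ⊕ Fin t → ℝ) i : ℂ)) =
          Sum.elim (Sum.elim (fun i => (x i : ℂ)) 0) 0 := by
        ext ((i | i) | i) <;> simp
      rw [he, this]
  have h1 : IsGreatest (tripleJoin T t).restrictedRayleighSet (2 + Fintype.card V + t) :=
    ⟨hmax, fun r hr => (hbound r hr).2⟩
  have h2 : IsLeast (tripleJoin T t).restrictedRayleighSet 0 := ⟨hmin, fun r hr => (hbound r hr).1⟩
  rw [laplacianSpread, maxRayleigh, algebraicConnectivity, h1.csSup_eq, h2.csInf_eq, sub_zero]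

end PickJoin

theorem exists_isPseudoNormal_laplacianSpread_eq {n : ℕ} (hn : 7 ≤ n) :
    ∃ Γ : Digraph (Fin n), Γ.IsPseudoNormal ∧ Γ.laplacianSpread = n := by
  obtain ⟨p, t, hp, hodd, ht, htp, rfl⟩ :
      ∃ p t : ℕ, 3 ≤ p ∧ Odd p ∧ 2 ≤ t ∧ t ≤ p ∧ n = 2 + p + t := by
    -- n - 2 is split as p + t as evenly as p odd and t ≤ p allow. The least admissible case is 7 =
    -- 2 + 3 + 2.
    obtain ⟨k, hk | hk | hk | hk⟩ : ∃ k, n = 4 * k ∨ n = 4 * k + 1 ∨ n = 4 * k + 2 ∨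
        n = 4 * k + 3 := ⟨n / 4, by omega⟩
    · exact ⟨2 * k - 1, 2 * k - 1, by omega, ⟨k - 1, by omega⟩, by omega, by omega, by omega⟩
    · exact ⟨2 * k + 1, 2 * k - 2, by omega, ⟨k, by omega⟩, by omega, by omega, by omega⟩
    · exact ⟨2 * k + 1, 2 * k - 1, by omega, ⟨k, by omega⟩, by omega, by omega, by omega⟩
    · exact ⟨2 * k + 1, 2 * k, by omega, ⟨k, by omega⟩, by omega, by omega, by omega⟩
  obtain ⟨T, hT⟩ := exists_isRegularPickTournament hp hodd
  let e : Fin (2 + p + t) ≃ (Fin 2 ⊕ Fin p) ⊕ Fin t :=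
    finSumFinEquiv.symm.trans (Equiv.sumCongr finSumFinEquiv.symm (Equiv.refl _))
  have hcard : t ≤ Fintype.card (Fin p) := by simpa using htp
  refine ⟨(tripleJoin T t).relabel e, (hT.isPseudoNormal_tripleJoin ht hcard).relabel e, ?_⟩
  rw [laplacianSpread_relabel, hT.laplacianSpread_tripleJoin ht hcard]
  simp

end Digraph

theorem theorem3p5 :
    (∀ p : ℕ, 3 ≤ p → Odd p →
      (∃ T : Digraph (Fin p), T.IsRegularPickTournament) ∧
      ∀ T : Digraph (Fin p), T.IsRegularPickTournament →
        ∀ t : ℕ, 2 ≤ t → t ≤ p →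
          (((Digraph.complete (Fin 2)).directedJoin T).directedJoin
            (Digraph.emptyDigraph (Fin t))).IsPseudoNormal ∧
          (((Digraph.complete (Fin 2)).directedJoin T).directedJoin
            (Digraph.emptyDigraph (Fin t))).laplacianSpread = ((2 + p + t : ℕ) : ℝ)) ∧
    (∀ n : ℕ, 2 ≤ n → ∀ Γ : Digraph (Fin n), Γ.IsPolygonal → Γ.laplacianSpread ≤ n) ∧
    (∀ n : ℕ, 7 ≤ n →
      ∃ Γ : Digraph (Fin n), Γ.IsPseudoNormal ∧ Γ.laplacianSpread = n) := by
  refine ⟨fun p hp hodd => ⟨Digraph.exists_isRegularPickTournament hp hodd,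
    fun T hT t ht htp => ?_⟩, fun n hn Γ hΓ => ?_,
    fun n hn => Digraph.exists_isPseudoNormal_laplacianSpread_eq hn⟩
  · have hcard : t ≤ Fintype.card (Fin p) := by simpa using htp
    refine ⟨hT.isPseudoNormal_tripleJoin ht hcard, ?_⟩
    refine (hT.laplacianSpread_tripleJoin ht hcard).trans ?_
    simp
  · have : Nontrivial (Fin n) := Fin.nontrivial_iff_two_le.2 hn
    simpa using hΓ.laplacianSpread_le
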